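/- Let $N\ge 1$, $c>0$, and let $S^-\subset\mathbb R^N$ be a bounded open set whose boundary $S$ is a Lyapunov surface (locally the graph of a $C^1$ function with $S^-$ on one side, with Hölder continuous unit normal). Let $n=(n_1,\dots,n_N)$ be the outward unit normal to $S$, $\delta_S$ the surface measure on $S$ regarded as a distribution on $\mathbb R^N$ (so $n_i\delta_S$ is the simple layer $\varphi\mapsto\int_S n_i\varphi\,dS$), $H_S^-$ the characteristic function of $S^-$ (equal to $1/2$ on $S$), $H$ the Heaviside function ($H(0)=1/2$), and $H_D^-(x,t)=H_S^-(x)H(t)$ the characteristic function of the semicylinder $D^-=S^-\times[0,\infty)$. Let $\hat U\in D'(\mathbb R^{N+1})$ be the Green function of the wave equation, i.e. the distribution with $$\Delta \hat U-c^{-2}\,\hat U_{,tt}=\delta(x)\delta(t),\qquad \hat U=0\ \text{ for } t<0 \text{ and for } \|x\|>ct,$$ and let $\hat W=\hat U*\delta(x)H(t)=\hat U\mathop{*}\limits_t H(t)$ be its antiderivative in $t$. Let $\mathop{*}\limits_x$ denote convolution over $x$ only: for a compactly supported finite signed measure $\mu$ on $\mathbb R^N$ and $V\in D'(\mathbb R^{N+1})$,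 $(V\mathop{*}\limits_x\mu,\varphi)=\big(V(x,t),\int\varphi(x+y,t)\,d\mu(y)\big)$. Then, in $D'(\mathbb R^{N+1})$, with summation over $i=1,\dots,N$, $$-\,\hat W_{,i}\mathop{*}\limits_x n_i\,\delta_S\;-\;c^{-2}\big(\hat U\mathop{*}\limits_x H_S^-\big)_{,t}\;=\;H_D^-(x,t).$$ -/

import Mathlib

open MeasureTheory TopologicalSpace Set
open scoped Distributions LineDeriv ContDiff NNReal

noncomputable section

namespace WaveGauss

/-! ### Auxiliary facts: weighted averages of translates of a smooth function -/

section Average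

variable {Y : Type} [MeasurableSpace Y] {G : Type} [NormedAddCommGroup G] [NormedSpace ℝ G]
  [FiniteDimensional ℝ G] [MeasurableSpace G] [BorelSpace G]

theorem avg_aesm {F : Type} [NormedAddCommGroup F] [NormedSpace ℝ F] {ν : Measure Y} {f : Y → ℝ}
    {j : Y → G} (hf : Integrable f ν) (hj : Measurable j) {φ : G → F} (hφ : Continuous φ) (z : G) :
    AEStronglyMeasurable (fun y => f y • φ (z + j y)) ν := by
  have : ProperSpace G := FiniteDimensional.proper ℝ G
  exact hf.aestronglyMeasurable.smul
    (hφ.comp_stronglyMeasurable (hj.const_add z).stronglyMeasurable).aestronglyMeasurable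

theorem avg_integrable {F : Type} [NormedAddCommGroup F] [NormedSpace ℝ F] {ν : Measure Y}
    {f : Y → ℝ} {j : Y → G} (hf : Integrable f ν) (hj : Measurable j) {φ : G → F}
    (hφ : Continuous φ) {C : ℝ} (hC : ∀ w, ‖φ w‖ ≤ C) (z : G) :
    Integrable (fun y => f y • φ (z + j y)) ν := by
  refine Integrable.mono' (hf.norm.mul_const C) (avg_aesm hf hj hφ z) (ae_of_all _ fun y => ?_)
  rw [norm_smul]
  exact mul_le_mul_of_nonneg_left (hC _) (norm_nonneg _)

theorem avg_hasFDerivAt {F : Type} [NormedAddCommGroup F] [NormedSpace ℝ F] {ν : Measure Y}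
    {f : Y → ℝ} {j : Y → G} (hf : Integrable f ν) (hj : Measurable j) {φ : G → F}
    (hφ : ContDiff ℝ ∞ φ) (hc : HasCompactSupport φ) (z : G) :
    HasFDerivAt (fun z => ∫ y, f y • φ (z + j y) ∂ν) (∫ y, f y • fderiv ℝ φ (z + j y) ∂ν) z := by
  obtain ⟨C₀, hC₀⟩ := hc.exists_bound_of_continuous hφ.continuous
  have hd : Continuous (fderiv ℝ φ) := hφ.continuous_fderiv (by simp)
  obtain ⟨C₁, hC₁⟩ := (hc.fderiv ℝ).exists_bound_of_continuous hd
  refine hasFDerivAt_integral_of_dominated_of_fderiv_le (s := univ)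
    (F' := fun z y => f y • fderiv ℝ φ (z + j y)) (bound := fun y => ‖f y‖ * C₁)
    Filter.univ_mem (Filter.Eventually.of_forall fun w => avg_aesm hf hj hφ.continuous w)
    (avg_integrable hf hj hφ.continuous hC₀ z) (avg_aesm hf hj hd z)
    (ae_of_all _ fun y w _ => ?_) (hf.norm.mul_const C₁) (ae_of_all _ fun y w _ => ?_)
  · rw [norm_smul]
    exact mul_le_mul_of_nonneg_left (hC₁ _) (norm_nonneg _)
  · have h1 : HasFDerivAt φ (fderiv ℝ φ (w + j y)) (w + j y) :=
      (hφ.differentiable (by simp) _).hasFDerivAt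
    have h2 := h1.comp w ((hasFDerivAt_id w).add_const (j y))
    exact h2.const_smul (f y)

theorem avg_smooth {ν : Measure Y} {f : Y → ℝ} {j : Y → G} (hf : Integrable f ν)
    (hj : Measurable j) (n : ℕ) : ∀ {F : Type} [NormedAddCommGroup F] [NormedSpace ℝ F] {φ : G → F},
    ContDiff ℝ ∞ φ → HasCompactSupport φ →
    ContDiff ℝ n (fun z => ∫ y, f y • φ (z + j y) ∂ν) ∧
    ∀ C : ℝ, (∀ w, ‖iteratedFDeriv ℝ n φ w‖ ≤ C) →
      ∀ z, ‖iteratedFDeriv ℝ n (fun z => ∫ y, f y • φ (z + j y) ∂ν) z‖ ≤ (∫ y, ‖f y‖ ∂ν) * C := by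
  induction n with
  | zero =>
    intro F _ _ φ hφ hc
    constructor
    · exact contDiff_zero.2 (continuous_iff_continuousAt.2 fun z =>
        (avg_hasFDerivAt hf hj hφ hc z).continuousAt)
    · intro C hC z
      simp only [norm_iteratedFDeriv_zero] at hC ⊢
      rw [← integral_mul_const]
      refine norm_integral_le_of_norm_le (hf.norm.mul_const C) (ae_of_all _ fun y => ?_)
      rw [norm_smul]
      exact mul_le_mul_of_nonneg_left (hC _) (norm_nonneg _)
  | succ n ih =>
    intro F _ _ φ hφ hc
    have hfd : fderiv ℝ (fun z => ∫ y, f y • φ (z + j y) ∂ν) =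
        fun z => ∫ y, f y • fderiv ℝ φ (z + j y) ∂ν :=
      funext fun z => (avg_hasFDerivAt hf hj hφ hc z).fderiv
    have hφ' : ContDiff ℝ ∞ (fderiv ℝ φ) := hφ.fderiv_right (by simp)
    obtain ⟨h1, h2⟩ := ih hφ' (hc.fderiv ℝ)
    constructor
    · push_cast
      rw [contDiff_succ_iff_fderiv]
      refine ⟨fun z => (avg_hasFDerivAt hf hj hφ hc z).differentiableAt, by simp, ?_⟩
      rw [hfd]
      exact h1
    · intro C hC z
      rw [← norm_iteratedFDeriv_fderiv, hfd]
      refine h2 C (fun w => ?_) z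
      rw [norm_iteratedFDeriv_fderiv]
      exact hC w

theorem avg_contDiff {F : Type} [NormedAddCommGroup F] [NormedSpace ℝ F] {ν : Measure Y}
    {f : Y → ℝ} {j : Y → G} (hf : Integrable f ν) (hj : Measurable j) {φ : G → F}
    (hφ : ContDiff ℝ ∞ φ) (hc : HasCompactSupport φ) :
    ContDiff ℝ ∞ (fun z => ∫ y, f y • φ (z + j y) ∂ν) :=
  contDiff_infty.2 fun n => (avg_smooth hf hj n hφ hc).1

theorem avg_eq_zero {Y G : Type} [MeasurableSpace Y] [NormedAddCommGroup G] {ν : Measure Y} {f : Y → ℝ} {j : Y → G} {L : Compacts G}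
    (hL : ∀ᵐ y ∂ν, f y ≠ 0 → j y ∈ L) {K : Compacts G} {φ : G → ℝ} (hφ : ∀ z ∉ K, φ z = 0)
    {z : G} (hz : z ∉ ((fun p : G × G => p.1 - p.2) '' ((K : Set G) ×ˢ (L : Set G)))) :
    ∫ y, f y • φ (z + j y) ∂ν = 0 := by
  refine integral_eq_zero_of_ae ?_
  filter_upwards [hL] with y hy
  by_cases h0 : f y = 0
  · simp [h0]
  · have : z + j y ∉ K := fun h => hz ⟨(z + j y, j y), ⟨h, hy h0⟩, by simp⟩
    simp [hφ _ this]

/-- The compact set `K - L`. -/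
def diffCompacts (K L : Compacts G) : Compacts G :=
  ⟨(fun p : G × G => p.1 - p.2) '' ((K : Set G) ×ˢ (L : Set G)),
    (K.isCompact.prod L.isCompact).image (continuous_fst.sub continuous_snd)⟩

/-- The continuous linear map `φ ↦ (z ↦ ∫ f(y) φ(z + j(y)) dν(y))` on smooth functions supported in
a fixed compact set. -/
def avgSupportedIn {ν : Measure Y} {f : Y → ℝ} {j : Y → G} (hf : Integrable f ν)
    (hj : Measurable j) {L : Compacts G} (hL : ∀ᵐ y ∂ν, f y ≠ 0 → j y ∈ L) (K : Compacts G) :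
    𝓓_{K}(G, ℝ) →L[ℝ] 𝓓_{diffCompacts K L}(G, ℝ) :=
  ContDiffMapSupportedIn.mkCLM ℝ (fun φ z => ∫ y, f y • φ (z + j y) ∂ν)
    (fun φ ψ z => by
      obtain ⟨C, hC⟩ := φ.hasCompactSupport.exists_bound_of_continuous φ.continuous
      obtain ⟨D, hD⟩ := ψ.hasCompactSupport.exists_bound_of_continuous ψ.continuous
      rw [← integral_add (avg_integrable hf hj φ.continuous hC z)
        (avg_integrable hf hj ψ.continuous hD z)]
      simp [mul_add])
    (fun c φ z => by
      rw [← integral_smul]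
      simp [mul_left_comm])
    (fun φ => avg_contDiff hf hj φ.contDiff φ.hasCompactSupport)
    (fun φ z hz => avg_eq_zero hL (fun w hw => φ.zero_on_compl hw) hz)
    (fun i _ => ⟨{i}, ∫ y, ‖f y‖ ∂ν, integral_nonneg fun _ => norm_nonneg _, fun φ z _ => by
      rw [Finset.sup_singleton]
      exact (avg_smooth hf hj i φ.contDiff φ.hasCompactSupport).2 _
        (fun w => ContDiffMapSupportedIn.norm_iteratedFDeriv_apply_le_seminorm_top ℝ) z⟩)

end Average

/-! ### Distributions on space-time -/

/-- The Euclidean space `ℝ^N`. -/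
abbrev Space (N : ℕ) : Type := EuclideanSpace ℝ (Fin N)

/-- Test functions on `ℝ^N × ℝ`, with points `(x, t)`. -/
abbrev Test (N : ℕ) : Type := 𝓓((⊤ : Opens (Space N × ℝ)), ℝ)

/-- Distributions on `ℝ^N × ℝ`. -/
abbrev Distr (N : ℕ) : Type := 𝓓'((⊤ : Opens (Space N × ℝ)), ℝ)

variable {N : ℕ}

/-- The partial derivative `V,_i` in the `i`-th space variable. -/
def dx (i : Fin N) (V : Distr N) : Distr N := ∂_{((EuclideanSpace.single i 1, 0) : Space N × ℝ)} V

/-- The partial derivative `V,_t` in time. -/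
def dt (V : Distr N) : Distr N := ∂_{((0, 1) : Space N × ℝ)} V

/-- The wave operator `□_c V = Δ V - c⁻² V,_tt`. -/
def waveOp (c : ℝ) (V : Distr N) : Distr N := (∑ i, dx i (dx i V)) - (c ^ 2)⁻¹ • dt (dt V)

/-- The Green function of the wave equation: a fundamental solution `□_c U = δ(x) δ(t)` satisfying
the radiation conditions `U = 0` for `t < 0` and for `‖x‖ > c t`. -/
structure IsGreenFunction (c : ℝ) (U : Distr N) : Prop where
  waveOp_eq : waveOp c U = Distribution.delta (0 : Space N × ℝ)
  vanish_past : Distribution.IsVanishingOn U {p : Space N × ℝ | p.2 < 0}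
  vanish_outside : Distribution.IsVanishingOn U {p : Space N × ℝ | c * p.2 < ‖p.1‖}

/-- The Heaviside function, with `H(0) = 1/2`. -/
def heaviside (t : ℝ) : ℝ := if t < 0 then 0 else if t = 0 then 1 / 2 else 1

open Classical in
/-- The characteristic function of an open set `Ω`, with the value `1/2` on the boundary. -/
def halfIndicator (Ω : Set (Space N)) (x : Space N) : ℝ :=
  if x ∈ Ω then 1 else if x ∈ frontier Ω then 1 / 2 else 0

/-- The regular distribution `φ ↦ ∫ f φ` given by a locally integrable function on space-time. -/
def regular (f : Space N × ℝ → ℝ) : Distr N :=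
  TestFunction.integralAgainstBilinCLM (ContinuousLinearMap.mul ℝ ℝ) volume f

/-! ### Convolution over `x` with a compactly supported measure on `ℝ^N` -/

/-- `f μ` is a finite signed measure on `ℝ^N` with compact support. -/
def IsCompactDensity (f : Space N → ℝ) (μ : Measure (Space N)) : Prop :=
  Integrable f μ ∧ ∃ L : Compacts (Space N), ∀ᵐ y ∂μ, f y ≠ 0 → y ∈ L

theorem measurable_shift : Measurable fun y : Space N => ((y, 0) : Space N × ℝ) :=
  measurable_id.prodMk measurable_const

theorem IsCompactDensity.exists_compacts {f : Space N → ℝ} {μ : Measure (Space N)}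
    (h : IsCompactDensity f μ) :
    ∃ L : Compacts (Space N × ℝ), ∀ᵐ y ∂μ, f y ≠ 0 → ((y, 0) : Space N × ℝ) ∈ L := by
  obtain ⟨L, hL⟩ := h.2
  refine ⟨⟨(fun y : Space N => ((y, 0) : Space N × ℝ)) '' L,
    L.isCompact.image (by fun_prop)⟩, ?_⟩
  filter_upwards [hL] with y hy h0
  exact ⟨y, hy h0, rfl⟩

theorem spaceAvg_aux {f : Space N → ℝ} {μ : Measure (Space N)} (h : IsCompactDensity f μ)
    (φ : Test N) :
    HasCompactSupport fun p : Space N × ℝ => ∫ y, f y • φ (p + (y, 0)) ∂μ := by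
  obtain ⟨L, hL⟩ := h.exists_compacts
  refine HasCompactSupport.intro
    (diffCompacts ⟨tsupport φ, φ.hasCompactSupport⟩ L).isCompact fun z hz => ?_
  exact avg_eq_zero (K := ⟨tsupport φ, φ.hasCompactSupport⟩) hL
    (fun w hw => image_eq_zero_of_notMem_tsupport hw) hz

/-- The continuous linear map `φ ↦ ((x, t) ↦ ∫ f(y) φ(x + y, t) dμ(y))` on test functions, for `f μ`
a finite signed measure with compact support. -/
def spaceAvgOf {f : Space N → ℝ} {μ : Measure (Space N)} (h : IsCompactDensity f μ) :
    Test N →L[ℝ] Test N :=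
  TestFunction.limitCLM ℝ
    (fun φ => ⟨fun p => ∫ y, f y • φ (p + (y, 0)) ∂μ,
      avg_contDiff h.1 measurable_shift φ.contDiff φ.hasCompactSupport,
      spaceAvg_aux h φ, fun _ _ => Opens.mem_top _⟩)
    (fun K _ => (TestFunction.ofSupportedInCLM ℝ (fun _ _ => Opens.mem_top _)).comp
      (avgSupportedIn h.1 measurable_shift h.exists_compacts.choose_spec K))
    (fun _ _ _ => rfl)

theorem spaceAvgOf_apply {f : Space N → ℝ} {μ : Measure (Space N)} (h : IsCompactDensity f μ)
    (φ : Test N) (x : Space N) (t : ℝ) :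
    spaceAvgOf h φ (x, t) = ∫ y, f y * φ (x + y, t) ∂μ := by
  change ∫ y, f y • φ ((x, t) + (y, 0)) ∂μ = _
  simp

open Classical in
/-- The convolution over `x` of a distribution `V` on `ℝ^N × ℝ` with the compactly supported signed
measure `f μ` on `ℝ^N`, given by `(V ∗ₓ f μ, φ) = (V(x, t), ∫ f(y) φ(x + y, t) dμ(y))`. -/
def spaceConv (V : Distr N) (f : Space N → ℝ) (μ : Measure (Space N)) : Distr N :=
  if h : IsCompactDensity f μ then (spaceAvgOf h).precompCompactConvergenceCLM ℝ V else 0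

theorem spaceConv_apply (V : Distr N) {f : Space N → ℝ} {μ : Measure (Space N)}
    (h : IsCompactDensity f μ) (φ : Test N) : spaceConv V f μ φ = V (spaceAvgOf h φ) := by
  rw [spaceConv, dif_pos h]
  rfl

/-! ### Convolution over `t` with the Heaviside function -/

/-- A smooth cutoff in time: `0` for `t ≤ -2` and `1` for `t ≥ -1`. -/
def cutoff (t : ℝ) : ℝ := Real.smoothTransition (t + 2)

theorem cutoff_contDiff : ContDiff ℝ ∞ fun p : Space N × ℝ => cutoff p.2 :=
  Real.smoothTransition.contDiff.comp (contDiff_snd.add contDiff_const)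

/-- The Heaviside function truncated to `t ≤ T`. -/
def truncHeaviside (T : ℝ) : ℝ → ℝ := (Icc 0 T).indicator heaviside

theorem heaviside_measurable : Measurable heaviside :=
  Measurable.ite measurableSet_Iio measurable_const
    (Measurable.ite (measurableSet_singleton 0) measurable_const measurable_const)

theorem truncHeaviside_integrable (T : ℝ) : Integrable (truncHeaviside T) volume := by
  refine (integrable_indicator_iff measurableSet_Icc).2 ?_
  refine IntegrableOn.of_bound (by simp) heaviside_measurable.aestronglyMeasurable 1
    (ae_of_all _ fun t => ?_)
  unfold heaviside
  split_ifs <;> norm_num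

theorem measurable_timeShift : Measurable fun s : ℝ => ((0, s) : Space N × ℝ) :=
  measurable_const.prodMk measurable_id

/-- The segment `{0} × [0, T]`. -/
def timeSegment (N : ℕ) (T : ℝ) : Compacts (Space N × ℝ) :=
  ⟨(fun s : ℝ => ((0, s) : Space N × ℝ)) '' Icc 0 T, isCompact_Icc.image (by fun_prop)⟩

theorem truncHeaviside_support (T : ℝ) :
    ∀ᵐ s : ℝ, truncHeaviside T s ≠ 0 → ((0, s) : Space N × ℝ) ∈ timeSegment N T :=
  ae_of_all _ fun s hs => ⟨s, by
    by_contra h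
    exact hs (indicator_of_notMem h _), rfl⟩

/-- A compact set of space-time lies in `{t ≤ T}` for some `T`. -/
theorem exists_time_bound (K : Compacts (Space N × ℝ)) : ∃ T : ℝ, ∀ p ∈ K, p.2 ≤ T := by
  obtain ⟨T, hT⟩ := (K.isCompact.image continuous_snd).bddAbove
  exact ⟨T, fun p hp => hT ⟨p, hp, rfl⟩⟩

theorem timeTail_eq {T : ℝ} {φ : Space N × ℝ → ℝ} (hT : ∀ p, φ p ≠ 0 → p.2 ≤ T)
    (p : Space N × ℝ) :
    cutoff p.2 * ∫ s, heaviside s * φ (p.1, p.2 + s) =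
      (∫ s, truncHeaviside (T + 2) s • φ (p + (0, s))) * cutoff p.2 := by
  rw [mul_comm]
  by_cases hp : p.2 ≤ -2
  · have : cutoff p.2 = 0 := Real.smoothTransition.zero_of_nonpos (by linarith)
    simp [this]
  · congr 2
    funext s
    have hadd : p + (0, s) = (p.1, p.2 + s) := by ext <;> simp
    rw [hadd, smul_eq_mul]
    by_cases hs : s ∈ Icc 0 (T + 2)
    · rw [truncHeaviside, indicator_of_mem hs]
    · rw [truncHeaviside, indicator_of_notMem hs, zero_mul]
      by_cases h0 : s < 0
      · simp [heaviside, h0]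
      · by_cases hφ : φ (p.1, p.2 + s) = 0
        · simp [hφ]
        · have h1 := hT _ hφ
          exact absurd ⟨not_lt.1 h0, by simp only at h1; linarith⟩ hs

/-- The cut off tail integral on smooth functions supported in a fixed compact set. -/
def timeTailSupportedIn (K : Compacts (Space N × ℝ)) :
    𝓓_{K}(Space N × ℝ, ℝ) →L[ℝ]
      𝓓_{diffCompacts K (timeSegment N ((exists_time_bound K).choose + 2))}(Space N × ℝ, ℝ) :=
  (ContDiffMapSupportedIn.bilinLeftCLM (ContinuousLinearMap.mul ℝ ℝ) cutoff_contDiff).comp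
    (avgSupportedIn (truncHeaviside_integrable _) measurable_timeShift
      (truncHeaviside_support _) K)

theorem timeTailSupportedIn_apply (K : Compacts (Space N × ℝ)) (φ : 𝓓_{K}(Space N × ℝ, ℝ))
    (p : Space N × ℝ) :
    timeTailSupportedIn K φ p = cutoff p.2 * ∫ s, heaviside s * φ (p.1, p.2 + s) := by
  have hT := (exists_time_bound K).choose_spec
  rw [timeTail_eq (T := (exists_time_bound K).choose)
    (fun q hq => hT q (by_contra fun h => hq (φ.zero_on_compl h))) p]
  rfl

/-- A test function, as a smooth function supported in the compact set `tsupport φ`. -/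
def toSupportedIn (φ : Test N) :
    𝓓_{(⟨tsupport φ, φ.hasCompactSupport⟩ : Compacts (Space N × ℝ))}(Space N × ℝ, ℝ) :=
  ContDiffMapSupportedIn.of_support_subset φ.contDiff (subset_tsupport φ)

theorem timeTail_aux (φ : Test N) :
    (fun p : Space N × ℝ => cutoff p.2 * ∫ s, heaviside s * φ (p.1, p.2 + s)) =
      timeTailSupportedIn _ (toSupportedIn φ) :=
  funext fun p => (timeTailSupportedIn_apply _ (toSupportedIn φ) p).symm

/-- The continuous linear map `φ ↦ ((x, t) ↦ χ(t) ∫ H(s) φ(x, t + s) ds)` on test functions, where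
`χ` is the cutoff, equal to `1` on a neighbourhood of `[0, ∞)`. -/
def timeTail : Test N →L[ℝ] Test N :=
  TestFunction.limitCLM ℝ
    (fun φ => ⟨fun p => cutoff p.2 * ∫ s, heaviside s * φ (p.1, p.2 + s),
      by rw [timeTail_aux φ]; exact ContDiffMapSupportedIn.contDiff _,
      by rw [timeTail_aux φ]; exact ContDiffMapSupportedIn.hasCompactSupport _,
      fun _ _ => Opens.mem_top _⟩)
    (fun K _ => (TestFunction.ofSupportedInCLM ℝ (fun _ _ => Opens.mem_top _)).comp
      (timeTailSupportedIn K))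
    (fun K _ φ => TestFunction.ext fun p => (timeTailSupportedIn_apply K φ p).symm)

theorem timeTail_apply (φ : Test N) (x : Space N) (t : ℝ) :
    timeTail φ (x, t) = cutoff t * ∫ s, heaviside s * φ (x, t + s) := rfl

/-- The convolution `W = U ∗ δ(x) H(t) = U ∗ₜ H(t)` of a distribution `U` vanishing for `t < 0` with
the Heaviside function in time, `(W, φ) = (U(x, t), χ(t) ∫ H(s) φ(x, t + s) ds)`. As usual for the
convolution of distributions supported in a half-line, a cutoff `χ` equal to `1` near `[0, ∞)` makes
the function on the right a test function; for `U` vanishing for `t < 0` its choice is immaterial. -/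
def timePrimitive (U : Distr N) : Distr N := timeTail.precompCompactConvergenceCLM ℝ U

theorem timePrimitive_apply (U : Distr N) (φ : Test N) : timePrimitive U φ = U (timeTail φ) := rfl

/-! ### Lyapunov domains -/

/-- `v` is the outward unit normal of `Ω` at the boundary point `x`: near `x`, up to an arbitrarily
thin cone about the tangent plane, `Ω` is the half-space `{y | ⟨v, y - x⟩ < 0}`. -/
def IsOutwardNormal (Ω : Set (Space N)) (x v : Space N) : Prop :=
  ‖v‖ = 1 ∧ ∀ ε > (0 : ℝ), ∃ δ > (0 : ℝ), ∀ y, ‖y - x‖ < δ →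
    (inner ℝ v (y - x) < -(ε * ‖y - x‖) → y ∈ Ω) ∧ (ε * ‖y - x‖ < inner ℝ v (y - x) → y ∉ Ω)

/-- The outward unit normal field `n` on the boundary of `Ω`. -/
def outwardNormal (Ω : Set (Space N)) (x : Space N) : Space N :=
  Classical.epsilon (IsOutwardNormal Ω x)

/-- `Ω` is a bounded open set whose boundary `S` is a Lyapunov surface: near each of its points `S`
is the graph of a `C¹` function over a hyperplane, in a direction `ν`, with `Ω` on one side of it,
and the unit normal of `S` is Hölder continuous. -/
structure IsLyapunovDomain (Ω : Set (Space N)) : Prop where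
  isOpen : IsOpen Ω
  isBounded : Bornology.IsBounded Ω
  local_graph : ∀ x ∈ frontier Ω, ∃ (ν : Space N) (g : Space N → ℝ) (r : ℝ),
    ‖ν‖ = 1 ∧ ContDiff ℝ 1 g ∧ 0 < r ∧
    ∀ y ∈ Metric.ball x r, y ∈ Ω ↔ inner ℝ ν y < g (y - (inner ℝ ν y : ℝ) • ν)
  normal_holder : ∃ C α : ℝ≥0, 0 < α ∧ α ≤ 1 ∧ HolderOnWith C α (outwardNormal Ω) (frontier Ω)

/-- The surface measure `dS` on the boundary of `Ω`: the `(N - 1)`-dimensional Hausdorff measure,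
normalised so as to agree with Lebesgue measure on `ℝ^(N-1)`. -/
def surfaceMeasure (Ω : Set (Space N)) : Measure (Space N) :=
  (Measure.euclideanHausdorffMeasure (N - 1)).restrict (frontier Ω)

/-- `V ∗ₓ n_i δ_S`, where `S` is the boundary of `Ω` and `n_i δ_S` is the simple layer on `S` with
density the `i`-th component of the outward unit normal. -/
def convNormalLayer (V : Distr N) (Ω : Set (Space N)) (i : Fin N) : Distr N :=
  spaceConv V (fun y => outwardNormal Ω y i) (surfaceMeasure Ω)

end WaveGauss

end

open WaveGauss

/-!
The identity is the convolution over `x` of two facts: `∂ᵢ H_Ω = -nᵢ δ_S`, the divergence theorem on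
`Ω`, and `Δ W - c⁻² U,_t = δ(x) H(t)`, the wave equation for `U` integrated once in time. Indeed
`W,_i ∗ₓ nᵢ δ_S = -(∂ᵢ ∂ᵢ W) ∗ₓ H_Ω`, so the left side is `(Δ W - c⁻² U,_t) ∗ₓ H_Ω`, which is
`H_Ω(x) H(t)`.

The second fact is `IsGreenFunction.timePrimitive_eq`: the equation for `U` is tested against the
tail integral `∫_t^∞ ψ ds`, whose second time derivative is `-ψ,_t` for `t > -1`, hence wherever it
matters for a distribution which vanishes for `t < 0`.

The divergence theorem `IsLyapunovDomain.setIntegral_fderiv` is proved from scratch, because the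
surface measure is a Hausdorff measure. A partition of unity reduces it to functions supported in a
ball where `Ω` lies below the graph of a `C¹` function `γ` over a hyperplane `ν^⊥`. There, the
measure preserving map `(x, s) ↦ x + (γ(x) + s) ν` and Fubini give
`∫_Ω ∂ₑψ = ∫ (⟨ν, e⟩ - ⟨∇γ, e⟩) ψ(x + γ(x) ν) dx` (`setIntegral_fderiv_height_neg`), and it remains
to recognize `n dS`:
* `n = (ν - ∇γ) / √(1 + |∇γ|²)`, as the cone condition determines the normal
  (`IsOutwardNormal.unique`) and is satisfied by the normalized gradient of a defining function
  (`isOutwardNormal_of_hasFDerivAt`);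
* `dS = √(1 + |∇γ|²) dx` by the area formula (`map_withDensity_normDet_eq_restrict_range`). Near each
  point, an immersion is bi-Lipschitz with constant close to `1` relative to its derivative, and the
  Hausdorff measure of a linear image is known, so the two measures agree locally up to a factor
  arbitrarily close to `1`.
-/

namespace WaveGauss

/-! ### The area formula for injective `C¹` immersions -/

section AreaFormula

open Module Filter
open scoped Topology ENNReal

/-- A comparison of the increments of `f` and `g` makes `f` a Lipschitz function of `g` on `A`,
even when `g` is not injective. -/
theorem euclideanHausdorffMeasure_image_le_of_edist_le {ι X Y : Type*} [EMetricSpace X]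
    [MeasurableSpace X] [BorelSpace X] [EMetricSpace Y] [MeasurableSpace Y] [BorelSpace Y]
    (d : ℕ) {f : ι → X} {g : ι → Y} {A : Set ι} {K : ℝ≥0}
    (h : ∀ x ∈ A, ∀ y ∈ A, edist (f x) (f y) ≤ K * edist (g x) (g y)) :
    μHE[d] (f '' A) ≤ (K : ℝ≥0∞) ^ d * μHE[d] (g '' A) := by
  rcases isEmpty_or_nonempty ι with hι | hι
  · simp [Set.eq_empty_of_isEmpty A]
  let k : Y → X := fun z => f (Function.invFunOn g A z)
  have hk : ∀ x ∈ A, k (g x) = f x := fun x hx => by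
    have hmem : g x ∈ g '' A := ⟨x, hx, rfl⟩
    have h1 := h _ (Function.invFunOn_mem hmem) x hx
    rw [Function.invFunOn_eq hmem, edist_self, mul_zero] at h1
    exact edist_le_zero.1 h1
  have himg : f '' A = k '' (g '' A) := by
    rw [image_image]
    exact (image_congr fun x hx => hk x hx).symm
  have hL : LipschitzOnWith K k (g '' A) := by
    rintro _ ⟨x, hx, rfl⟩ _ ⟨y, hy, rfl⟩
    rw [hk x hx, hk y hy]
    exact h x hx y hy
  have := hL.hausdorffMeasure_image_le (d := d) (Nat.cast_nonneg d)
  rw [himg, Measure.euclideanHausdorffMeasure_def, Measure.euclideanHausdorffMeasure_def,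
    Measure.smul_apply, Measure.smul_apply, ENNReal.smul_def, ENNReal.smul_def, smul_eq_mul,
    smul_eq_mul, mul_left_comm]
  rw [ENNReal.rpow_natCast] at this
  gcongr

/-- Inequality between measures can be checked locally. -/
theorem measure_le_of_locally_le {X : Type*} [TopologicalSpace X] [SecondCountableTopology X]
    [MeasurableSpace X] [BorelSpace X] {μ ν : Measure X}
    (h : ∀ x, ∃ U ∈ 𝓝 x, ∀ A ⊆ U, MeasurableSet A → μ A ≤ ν A) : μ ≤ ν := by
  have h' : ∀ x, ∃ U : Set X, IsOpen U ∧ x ∈ U ∧ ∀ A ⊆ U, MeasurableSet A → μ A ≤ ν A := by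
    intro x
    obtain ⟨U, hU, hA⟩ := h x
    obtain ⟨V, hVU, hV, hx⟩ := mem_nhds_iff.1 hU
    exact ⟨V, hV, hx, fun A hAV => hA A (hAV.trans hVU)⟩
  choose U hUo hxU hU using h'
  obtain ⟨t, ht, hcov⟩ := TopologicalSpace.countable_cover_nhds fun x => (hUo x).mem_nhds (hxU x)
  rcases isEmpty_or_nonempty X with hX | hX
  · exact Measure.le_iff.2 fun s _ => by simp [Set.eq_empty_of_isEmpty s]
  have htne : t.Nonempty := by
    rw [nonempty_iff_ne_empty]
    rintro rfl
    simp at hcov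
    exact hX.elim fun x => (hcov ▸ mem_univ x : x ∈ (∅ : Set X))
  obtain ⟨u, rfl⟩ := ht.exists_eq_range htne
  refine Measure.le_iff.2 fun s hs => ?_
  let D := disjointed fun n => U (u n)
  have hDm : ∀ n, MeasurableSet (D n) :=
    MeasurableSet.disjointed fun n => (hUo _).measurableSet
  have hs' : s = ⋃ n, s ∩ D n := by
    rw [← inter_iUnion, iUnion_disjointed]
    simpa using (congrArg (s ∩ ·) hcov).symm
  have hdis : Pairwise (Function.onFun Disjoint fun n => s ∩ D n) := fun i j hij =>
    ((disjoint_disjointed _) hij).mono inter_subset_right inter_subset_right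
  rw [hs', measure_iUnion hdis fun n => hs.inter (hDm n),
    measure_iUnion hdis fun n => hs.inter (hDm n)]
  exact ENNReal.tsum_le_tsum fun n =>
    hU (u n) _ (inter_subset_right.trans (disjointed_subset _ _)) (hs.inter (hDm n))

variable {E V : Type*} [NormedAddCommGroup E] [InnerProductSpace ℝ E] [FiniteDimensional ℝ E]
  [NormedAddCommGroup V] [InnerProductSpace ℝ V]

/-- Near a point where `f` has an injective strict derivative `L`, increments of `f` and of `L`
have the same length up to a factor arbitrarily close to `1`. -/
theorem exists_nhds_edist_le {f : E → V} {L : E →L[ℝ] V} {x₀ : E} (hf : HasStrictFDerivAt f L x₀)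
    (hL : LinearMap.ker (L : E →ₗ[ℝ] V) = ⊥) {K : ℝ≥0} (hK : 1 < K) :
    ∃ U ∈ 𝓝 x₀, ∀ x ∈ U, ∀ y ∈ U, edist (f x) (f y) ≤ K * edist (L x) (L y) ∧
      edist (L x) (L y) ≤ K * edist (f x) (f y) := by
  obtain ⟨C, hC0, hC⟩ := LinearMap.exists_antilipschitzWith (L : E →ₗ[ℝ] V) hL
  have hK' : (1 : ℝ) < K := by exact_mod_cast hK
  have hC0' : (0 : ℝ) < C := by exact_mod_cast hC0
  -- `η` is the admissible relative error in the increments of `f`: `1 + η ≤ K`, `1 ≤ K (1 - η)`.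
  let η : ℝ := (K - 1) / K
  have hη : 0 < η := div_pos (by linarith) (by linarith)
  have hηK : K * (1 - η) = 1 := by
    simp only [η]; field_simp; ring
  have hη1 : 1 + η ≤ K := by nlinarith [mul_pos hη hη]
  let c : ℝ≥0 := ⟨η / C, by positivity⟩
  have hc : 0 < c := by
    rw [← NNReal.coe_pos]; exact div_pos hη hC0'
  obtain ⟨U, hU, hA⟩ := hf.approximates_deriv_on_nhds (Or.inr hc)
  refine ⟨U, hU, fun x hx y hy => ?_⟩
  have h1 : ‖f x - f y - L (x - y)‖ ≤ η / C * ‖x - y‖ := hA x hx y hy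
  have h2 : ‖x - y‖ ≤ C * ‖L (x - y)‖ := by
    have := hC.le_mul_dist x y
    rwa [dist_eq_norm, dist_eq_norm, ContinuousLinearMap.coe_coe, ← map_sub] at this
  have h3 : ‖f x - f y - L (x - y)‖ ≤ η * ‖L (x - y)‖ := by
    refine h1.trans ?_
    calc η / C * ‖x - y‖ ≤ η / C * (C * ‖L (x - y)‖) := by gcongr
      _ = η * ‖L (x - y)‖ := by field_simp
  have h4 : ‖f x - f y‖ ≤ K * ‖L (x - y)‖ := by
    have := norm_le_norm_add_norm_sub' (f x - f y) (L (x - y))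
    nlinarith [norm_nonneg (L (x - y))]
  have h5 : ‖L (x - y)‖ ≤ K * ‖f x - f y‖ := by
    have h6 := norm_le_norm_add_norm_sub (f x - f y) (L (x - y))
    have h7 : (1 - η) * ‖L (x - y)‖ ≤ ‖f x - f y‖ := by linarith
    calc ‖L (x - y)‖ = K * ((1 - η) * ‖L (x - y)‖) := by rw [← mul_assoc, hηK, one_mul]
      _ ≤ _ := by gcongr
  rw [edist_nndist, edist_nndist, ← ENNReal.coe_mul, ← ENNReal.coe_mul, ENNReal.coe_le_coe,
    ENNReal.coe_le_coe, ← NNReal.coe_le_coe, ← NNReal.coe_le_coe]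
  push_cast
  rw [dist_eq_norm, dist_eq_norm, ← map_sub]
  exact ⟨h4, h5⟩

/-- If `J` is continuous and positive and, near each point `x`, the measure `m` agrees with
`J x • μ` up to a factor arbitrarily close to `1`, then `m` has density `J`. -/
theorem eq_withDensity_of_locally {X : Type*} [TopologicalSpace X] [SecondCountableTopology X]
    [MeasurableSpace X] [BorelSpace X] {m μ : Measure X} {J : X → ℝ} (hJ : Continuous J)
    (hpos : ∀ x, 0 < J x) (d : ℕ)
    (h : ∀ x, ∀ K : ℝ≥0, 1 < K → ∃ U ∈ 𝓝 x, ∀ A ⊆ U, MeasurableSet A →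
      m A ≤ (K : ℝ≥0∞) ^ d * (ENNReal.ofReal (J x) * μ A) ∧
      ENNReal.ofReal (J x) * μ A ≤ (K : ℝ≥0∞) ^ d * m A) :
    m = μ.withDensity fun x => ENNReal.ofReal (J x) := by
  set ρ := μ.withDensity fun x => ENNReal.ofReal (J x) with hρ
  have key : ∀ x, ∀ K : ℝ≥0, 1 < K → ∃ U ∈ 𝓝 x, ∀ A ⊆ U, MeasurableSet A →
      m A ≤ (K : ℝ≥0∞) ^ (d + 1) * ρ A ∧ ρ A ≤ (K : ℝ≥0∞) ^ (d + 1) * m A := by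
    intro x K hK
    have hK' : (1 : ℝ) < K := by exact_mod_cast hK
    obtain ⟨U, hU, hA⟩ := h x K hK
    have h1 : ∀ᶠ y in 𝓝 x, J y < K * J x :=
      hJ.continuousAt.eventually_lt continuousAt_const (by nlinarith [hpos x])
    have h2 : ∀ᶠ y in 𝓝 x, J x < K * J y :=
      continuousAt_const.eventually_lt (by fun_prop) (by nlinarith [hpos x])
    refine ⟨U ∩ {y | J y < K * J x ∧ J x < K * J y}, inter_mem hU (h1.and h2),
      fun A hAU hAm => ?_⟩
    obtain ⟨h3, h4⟩ := hA A (hAU.trans inter_subset_left) hAm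
    have hmul : ∀ a : ℝ, ENNReal.ofReal (K * a) = K * ENNReal.ofReal a := fun a => by
      rw [ENNReal.ofReal_mul K.coe_nonneg, ENNReal.ofReal_coe_nnreal]
    have h5 : ENNReal.ofReal (J x) * μ A ≤ K * ρ A := by
      rw [hρ, withDensity_apply _ hAm, ← setLIntegral_const,
        ← lintegral_const_mul _ (by fun_prop)]
      refine setLIntegral_mono' hAm fun y hy => ?_
      rw [← hmul]
      exact ENNReal.ofReal_le_ofReal (hAU hy).2.2.le
    have h6 : ρ A ≤ K * (ENNReal.ofReal (J x) * μ A) := by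
      rw [hρ, withDensity_apply _ hAm, ← mul_assoc, ← hmul, ← setLIntegral_const]
      exact setLIntegral_mono' hAm fun y hy => ENNReal.ofReal_le_ofReal (hAU hy).2.1.le
    constructor
    · calc m A ≤ _ := h3
        _ ≤ (K : ℝ≥0∞) ^ d * (K * ρ A) := by gcongr
        _ = _ := by rw [pow_succ, mul_assoc]
    · calc ρ A ≤ _ := h6
        _ ≤ K * ((K : ℝ≥0∞) ^ d * m A) := by gcongr
        _ = _ := by rw [pow_succ', mul_assoc]
  have hglob : ∀ K : ℝ≥0, 1 < K → m ≤ (K : ℝ≥0∞) ^ (d + 1) • ρ ∧ ρ ≤ (K : ℝ≥0∞) ^ (d + 1) • m := by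
    refine fun K hK => ⟨measure_le_of_locally_le fun x => ?_, measure_le_of_locally_le fun x => ?_⟩
    all_goals
      obtain ⟨U, hU, hA⟩ := key x K hK
      refine ⟨U, hU, fun A hAU hAm => ?_⟩
      simpa using by first | exact (hA A hAU hAm).1 | exact (hA A hAU hAm).2
  have hlim : ∀ a : ℝ≥0∞, Tendsto (fun K : ℝ≥0 => (K : ℝ≥0∞) ^ (d + 1) * a) (𝓝[>] 1) (𝓝 a) := by
    intro a
    have h1 : Tendsto (fun K : ℝ≥0 => (K : ℝ≥0∞) ^ (d + 1)) (𝓝[>] 1) (𝓝 1) := by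
      have : Continuous fun K : ℝ≥0 => ((K ^ (d + 1) : ℝ≥0) : ℝ≥0∞) :=
        ENNReal.continuous_coe.comp (continuous_pow _)
      simpa using (this.tendsto 1).mono_left nhdsWithin_le_nhds
    simpa using ENNReal.Tendsto.mul_const h1 (Or.inl one_ne_zero)
  refine le_antisymm (Measure.le_iff.2 fun s _ => ?_) (Measure.le_iff.2 fun s _ => ?_)
  · refine ge_of_tendsto (hlim (ρ s)) ?_
    filter_upwards [self_mem_nhdsWithin] with K hK
    simpa using (hglob K hK).1 s
  · refine ge_of_tendsto (hlim (m s)) ?_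
    filter_upwards [self_mem_nhdsWithin] with K hK
    simpa using (hglob K hK).2 s

variable [MeasurableSpace E] [BorelSpace E] [MeasurableSpace V] [BorelSpace V]

/-- The area formula for a measurable embedding with continuous injective derivative. The
continuity of the Jacobian `J` is a hypothesis to allow for explicit Jacobians. -/
theorem map_withDensity_normDet_eq_restrict_range {f : E → V} {f' : E → E →L[ℝ] V} {J : E → ℝ}
    (hfe : MeasurableEmbedding f) (hf : ∀ x, HasStrictFDerivAt f (f' x) x)
    (hinj : ∀ x, LinearMap.ker (f' x : E →ₗ[ℝ] V) = ⊥) (hJ : Continuous J)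
    (hJf : ∀ x, (f' x : E →ₗ[ℝ] V).normDet = J x) (hpos : ∀ x, 0 < J x) :
    ((volume : Measure E).withDensity fun x => ENNReal.ofReal (J x)).map f =
      μHE[finrank ℝ E].restrict (range f) := by
  rw [← hfe.map_comap]
  congr 1
  refine (eq_withDensity_of_locally hJ hpos (finrank ℝ E) fun x K hK => ?_).symm
  obtain ⟨U, hU, h⟩ := exists_nhds_edist_le (hf x) (hinj x) hK
  refine ⟨U, hU, fun A hAU _ => ?_⟩
  rw [hfe.comap_apply, ← hJf,
    ← LinearMap.euclideanHausdorffMeasure_image_eq_normDet_mul_volume]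
  exact ⟨euclideanHausdorffMeasure_image_le_of_edist_le _ fun a ha b hb =>
      (h a (hAU ha) b (hAU hb)).1,
    euclideanHausdorffMeasure_image_le_of_edist_le _ fun a ha b hb =>
      (h a (hAU ha) b (hAU hb)).2⟩

end AreaFormula

/-! ### Graphs over a hyperplane -/

section Graph

open Module Filter
open scoped Topology ENNReal

variable {N : ℕ}

/-- The parametrization `x ↦ x + γ(x) ν` of the graph of `γ` over the hyperplane orthogonal to
`ν`. -/
noncomputable def graphMap (ν : Space N) (γ : (ℝ ∙ ν)ᗮ → ℝ) (x : (ℝ ∙ ν)ᗮ) : Space N :=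
  x + γ x • ν

/-- The derivative of `graphMap ν γ` at a point where `γ` has gradient `a`. -/
noncomputable def graphDeriv (ν : Space N) (a : (ℝ ∙ ν)ᗮ) : (ℝ ∙ ν)ᗮ →L[ℝ] Space N :=
  (ℝ ∙ ν)ᗮ.subtypeL + (innerSL ℝ a).smulRight ν

variable {ν : Space N}

theorem graphDeriv_apply (a x : (ℝ ∙ ν)ᗮ) : graphDeriv ν a x = x + (inner ℝ a x : ℝ) • ν := rfl

theorem inner_orthogonal (x : (ℝ ∙ ν)ᗮ) : inner ℝ ν (x : Space N) = 0 :=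
  Submodule.mem_orthogonal_singleton_iff_inner_right.1 x.2

theorem inner_orthogonal' (x : (ℝ ∙ ν)ᗮ) : inner ℝ (x : Space N) ν = 0 :=
  Submodule.mem_orthogonal_singleton_iff_inner_left.1 x.2

theorem inner_add_smul (hν : ‖ν‖ = 1) (x : (ℝ ∙ ν)ᗮ) (s : ℝ) :
    inner ℝ ν ((x : Space N) + s • ν) = s := by
  rw [inner_add_right, inner_orthogonal, inner_smul_right, real_inner_self_eq_norm_sq, hν]
  simp

theorem add_smul_inj (hν : ‖ν‖ = 1) {x y : (ℝ ∙ ν)ᗮ} {s t : ℝ}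
    (h : (x : Space N) + s • ν = y + t • ν) : x = y ∧ s = t := by
  have hst : s = t := by rw [← inner_add_smul hν x s, h, inner_add_smul hν]
  subst hst
  exact ⟨Subtype.ext (add_right_cancel h), rfl⟩

theorem graphDeriv_ker (hν : ‖ν‖ = 1) (a : (ℝ ∙ ν)ᗮ) :
    LinearMap.ker (graphDeriv ν a : (ℝ ∙ ν)ᗮ →ₗ[ℝ] Space N) = ⊥ := by
  refine LinearMap.ker_eq_bot'.2 fun x hx => ?_
  have : ((x : Space N) + (inner ℝ a x : ℝ) • ν) = (0 : (ℝ ∙ ν)ᗮ) + (0 : ℝ) • ν := by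
    simpa [graphDeriv_apply] using hx
  exact (add_smul_inj hν this).1

theorem graphDeriv_normDet (hν : ‖ν‖ = 1) (a : (ℝ ∙ ν)ᗮ) :
    (graphDeriv ν a : (ℝ ∙ ν)ᗮ →ₗ[ℝ] Space N).normDet = √(1 + ‖a‖ ^ 2) := by
  have hsq := LinearMap.normDet_sq (graphDeriv ν a : (ℝ ∙ ν)ᗮ →ₗ[ℝ] Space N)
  have hcomp : (graphDeriv ν a : (ℝ ∙ ν)ᗮ →ₗ[ℝ] Space N).adjoint ∘ₗ
      (graphDeriv ν a : (ℝ ∙ ν)ᗮ →ₗ[ℝ] Space N) =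
      LinearMap.transvection (innerSL ℝ a : (ℝ ∙ ν)ᗮ →ₗ[ℝ] ℝ) a := by
    ext1 x
    refine ext_inner_right ℝ fun y => ?_
    rw [LinearMap.comp_apply, LinearMap.adjoint_inner_left]
    simp only [ContinuousLinearMap.coe_coe, graphDeriv_apply, LinearMap.transvection.apply,
      innerSL_apply_apply, inner_add_left, inner_add_right, inner_smul_left, inner_smul_right,
      inner_orthogonal, inner_orthogonal', real_inner_self_eq_norm_sq, hν, Submodule.coe_inner]
    simp [mul_comm]
  rw [hcomp, LinearMap.transvection.det] at hsq
  simp only [ContinuousLinearMap.coe_coe, innerSL_apply_apply, real_inner_self_eq_norm_sq,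
    RCLike.ofReal_real_eq_id, id_eq] at hsq
  rw [← hsq, Real.sqrt_sq (LinearMap.normDet_nonneg _)]

variable {γ : (ℝ ∙ ν)ᗮ → ℝ}

theorem continuous_gradient (hγ : ContDiff ℝ 1 γ) : Continuous (gradient γ) :=
  (InnerProductSpace.toDual ℝ (ℝ ∙ ν)ᗮ).symm.continuous.comp (hγ.continuous_fderiv (by simp))

theorem innerSL_gradient (x : (ℝ ∙ ν)ᗮ) : innerSL ℝ (gradient γ x) = fderiv ℝ γ x :=
  (InnerProductSpace.toDual ℝ (ℝ ∙ ν)ᗮ).apply_symm_apply _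

theorem graphMap_hasStrictFDerivAt (hγ : ContDiff ℝ 1 γ) (x : (ℝ ∙ ν)ᗮ) :
    HasStrictFDerivAt (graphMap ν γ) (graphDeriv ν (gradient γ x)) x := by
  have h : HasStrictFDerivAt γ (innerSL ℝ (gradient γ x)) x := by
    rw [innerSL_gradient]
    exact hγ.contDiffAt.hasStrictFDerivAt (by simp)
  exact (ℝ ∙ ν)ᗮ.subtypeL.hasStrictFDerivAt.add (h.smul_const ν)

theorem graphMap_continuous (hγ : Continuous γ) : Continuous (graphMap ν γ) := by
  unfold graphMap
  fun_prop

theorem graphMap_measurableEmbedding (hν : ‖ν‖ = 1) (hγ : Continuous γ) :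
    MeasurableEmbedding (graphMap ν γ) :=
  (graphMap_continuous hγ).measurableEmbedding fun _ _ h => (add_smul_inj hν h).1

theorem finrank_orthogonal_of_norm_eq_one (hν : ‖ν‖ = 1) : finrank ℝ (ℝ ∙ ν)ᗮ = N - 1 := by
  have h0 : ν ≠ 0 := by
    rintro rfl
    simp at hν
  have h1 := (ℝ ∙ ν).finrank_add_finrank_orthogonal
  rw [finrank_span_singleton h0, finrank_euclideanSpace_fin] at h1
  omega

/-- The surface element of a graph is `√(1 + |∇γ|²) dx`. -/
theorem graphMap_map_withDensity (hν : ‖ν‖ = 1) (hγ : ContDiff ℝ 1 γ) :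
    ((volume : Measure (ℝ ∙ ν)ᗮ).withDensity
      fun x => ENNReal.ofReal (√(1 + ‖gradient γ x‖ ^ 2))).map (graphMap ν γ) =
      μHE[N - 1].restrict (range (graphMap ν γ)) := by
  have hc := continuous_gradient hγ
  rw [map_withDensity_normDet_eq_restrict_range (graphMap_measurableEmbedding hν hγ.continuous)
    (graphMap_hasStrictFDerivAt hγ) (fun x => graphDeriv_ker hν _) (by fun_prop)
    (fun x => graphDeriv_normDet hν _) (fun x => by positivity),
    finrank_orthogonal_of_norm_eq_one hν]

theorem setIntegral_range_graphMap (hν : ‖ν‖ = 1) (hγ : ContDiff ℝ 1 γ) (k : Space N → ℝ) :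
    ∫ y in range (graphMap ν γ), k y ∂μHE[N - 1] =
      ∫ x, √(1 + ‖gradient γ x‖ ^ 2) * k (graphMap ν γ x) := by
  have hc := continuous_gradient hγ
  rw [← graphMap_map_withDensity hν hγ,
    (graphMap_measurableEmbedding hν hγ.continuous).integral_map,
    integral_withDensity_eq_integral_toReal_smul (by fun_prop)
      (ae_of_all _ fun x => ENNReal.ofReal_lt_top)]
  refine integral_congr_ae (ae_of_all _ fun x => ?_)
  simp only [smul_eq_mul]
  rw [ENNReal.toReal_ofReal (Real.sqrt_nonneg _)]

theorem measure_inter_range_graphMap_lt_top (hν : ‖ν‖ = 1) (hγ : ContDiff ℝ 1 γ) {B : Set (Space N)}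
    (hB : IsCompact B) : μHE[N - 1] (B ∩ range (graphMap ν γ)) < ⊤ := by
  have hc := continuous_gradient hγ
  rw [← Measure.restrict_apply hB.measurableSet, ← graphMap_map_withDensity hν hγ,
    Measure.map_apply (graphMap_continuous hγ.continuous).measurable hB.measurableSet]
  have hK : IsCompact (graphMap ν γ ⁻¹' B) := by
    refine Metric.isCompact_of_isClosed_isBounded
      (hB.isClosed.preimage (graphMap_continuous hγ.continuous)) ?_
    obtain ⟨R, hR⟩ := hB.isBounded.exists_norm_le
    refine isBounded_iff_forall_norm_le.2 ⟨R, fun x hx => ?_⟩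
    have h1 : inner ℝ (x : Space N) (graphMap ν γ x) = ‖x‖ ^ 2 := by
      rw [graphMap, inner_add_right, inner_smul_right, inner_orthogonal',
        real_inner_self_eq_norm_sq]
      simp
    have h2 := real_inner_le_norm (x : Space N) (graphMap ν γ x)
    have h3 := hR _ hx
    rw [h1, Submodule.coe_norm] at h2
    by_contra! hlt
    have : 0 ≤ R := (norm_nonneg _).trans h3
    have h4 : ‖(x : Space N)‖ = ‖x‖ := rfl
    nlinarith [norm_nonneg x]
  rw [withDensity_apply _ hK.measurableSet]
  exact setLIntegral_lt_top_of_isCompact hK.measure_lt_top.ne hK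
    (continuous_real_toNNReal.comp
      (by fun_prop : Continuous fun x => √(1 + ‖gradient γ x‖ ^ 2)))

end Graph

/-! ### Outward normals of sublevel sets -/

section Normal

open Filter
open scoped Topology

variable {N : ℕ} {Ω : Set (Space N)}

/-- The cone condition determines the outward normal, so that `outwardNormal`, a choice by
`Classical.epsilon`, can be computed. -/
theorem IsOutwardNormal.unique {x v w : Space N} (hv : IsOutwardNormal Ω x v)
    (hw : IsOutwardNormal Ω x w) : v = w := by
  by_contra hne
  -- For `v ≠ w`, a short step from `x` in the direction `w - v` lies both inside and outside `Ω`.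
  let u := w - v
  have hlt : inner ℝ v w < (1 : ℝ) := (inner_lt_one_iff_real_of_norm_eq_one hv.1 hw.1).2 hne
  have hvu : inner ℝ v u = inner ℝ v w - (1 : ℝ) := by
    simp [u, inner_sub_right, hv.1]
  have hwu : inner ℝ w u = 1 - (inner ℝ v w : ℝ) := by
    simp [u, inner_sub_right, hw.1, real_inner_comm]
  have hu : 0 < ‖u‖ := norm_pos_iff.2 (sub_ne_zero.2 (Ne.symm hne))
  set p : ℝ := 1 - inner ℝ v w
  have hp : 0 < p := by simp only [p]; linarith
  obtain ⟨δ₁, hδ₁, h₁⟩ := hv.2 (p / (2 * ‖u‖)) (by positivity)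
  obtain ⟨δ₂, hδ₂, h₂⟩ := hw.2 (p / (2 * ‖u‖)) (by positivity)
  let τ : ℝ := min δ₁ δ₂ / (2 * ‖u‖)
  have hτ : 0 < τ := div_pos (lt_min hδ₁ hδ₂) (by positivity)
  have hyx : x + τ • u - x = τ • u := by simp
  have hn : ‖τ • u‖ = τ * ‖u‖ := by rw [norm_smul, Real.norm_of_nonneg hτ.le]
  have hn' : τ * ‖u‖ = min δ₁ δ₂ / 2 := by simp only [τ]; field_simp
  have hmin : 0 < min δ₁ δ₂ := lt_min hδ₁ hδ₂
  have hcone : p / (2 * ‖u‖) * (τ * ‖u‖) = τ * p / 2 := by field_simp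
  have hτp : 0 < τ * p := mul_pos hτ hp
  have hin : x + τ • u ∈ Ω := by
    refine (h₁ _ ?_).1 ?_
    · rw [hyx, hn, hn']; linarith [min_le_left δ₁ δ₂]
    · rw [hyx, hn, hcone, inner_smul_right, hvu]
      simp only [p] at hτp ⊢
      linarith
  refine (h₂ _ ?_).2 ?_ hin
  · rw [hyx, hn, hn']; linarith [min_le_right δ₁ δ₂]
  · rw [hyx, hn, hcone, inner_smul_right, hwu]
    linarith

theorem IsOutwardNormal.outwardNormal_eq {x v : Space N} (hv : IsOutwardNormal Ω x v) :
    outwardNormal Ω x = v :=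
  (Classical.epsilon_spec (p := IsOutwardNormal Ω x) ⟨v, hv⟩).unique hv

/-- The normalized gradient of a defining function is an outward normal. -/
theorem isOutwardNormal_of_hasFDerivAt {x a : Space N} {h : Space N → ℝ}
    (hd : HasFDerivAt h (innerSL ℝ a) x) (ha : a ≠ 0) (h0 : h x = 0)
    (hΩ : ∀ᶠ y in 𝓝 x, y ∈ Ω ↔ h y < 0) : IsOutwardNormal Ω x (‖a‖⁻¹ • a) := by
  have ha' : 0 < ‖a‖ := norm_pos_iff.2 ha
  refine ⟨by rw [norm_smul, norm_inv, norm_norm, inv_mul_cancel₀ ha'.ne'], fun ε hε => ?_⟩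
  have hlo := hd.isLittleO.def (mul_pos hε ha')
  obtain ⟨δ, hδ, hB⟩ := Metric.eventually_nhds_iff.1 (hlo.and hΩ)
  refine ⟨δ, hδ, fun y hy => ?_⟩
  obtain ⟨h1, h2⟩ := hB (y := y) (by rwa [dist_eq_norm])
  rw [h0, sub_zero, innerSL_apply_apply, Real.norm_eq_abs, abs_le] at h1
  have h3 : inner ℝ a (y - x) = ‖a‖ * inner ℝ (‖a‖⁻¹ • a) (y - x) := by
    rw [real_inner_smul_left, ← mul_assoc, mul_inv_cancel₀ ha'.ne', one_mul]
  set q : ℝ := inner ℝ (‖a‖⁻¹ • a) (y - x)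
  rw [h3] at h1
  constructor
  · intro hq
    rw [h2]
    nlinarith
  · intro hq
    rw [h2]
    nlinarith

end Normal

/-! ### The divergence theorem below a graph -/

section BelowGraph

open Module Filter
open scoped Topology

variable {N : ℕ} {ν : Space N} {γ : (ℝ ∙ ν)ᗮ → ℝ}

/-- The height of `y` above the graph of `γ`, in the direction `ν`. -/
noncomputable def height (ν : Space N) (γ : (ℝ ∙ ν)ᗮ → ℝ) (y : Space N) : ℝ :=
  inner ℝ ν y - γ ((ℝ ∙ ν)ᗮ.orthogonalProjectionOnto y)

theorem coe_orthogonalProjectionOnto (hν : ‖ν‖ = 1) (y : Space N) :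
    ((ℝ ∙ ν)ᗮ.orthogonalProjectionOnto y : Space N) = y - (inner ℝ ν y : ℝ) • ν := by
  rw [Submodule.coe_orthogonalProjectionOnto_apply, Submodule.starProjection_orthogonal_val,
    Submodule.starProjection_unit_singleton ℝ hν]

theorem orthogonalProjectionOnto_add_smul (hν : ‖ν‖ = 1) (x : (ℝ ∙ ν)ᗮ) (s : ℝ) :
    (ℝ ∙ ν)ᗮ.orthogonalProjectionOnto ((x : Space N) + s • ν) = x := by
  ext1
  rw [coe_orthogonalProjectionOnto hν, inner_add_smul hν, add_sub_cancel_right]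

/-- The homeomorphism `(x, s) ↦ x + (γ(x) + s) ν`, which straightens the graph of `γ`. -/
noncomputable def graphHomeo (hν : ‖ν‖ = 1) (hγ : Continuous γ) : (ℝ ∙ ν)ᗮ × ℝ ≃ₜ Space N where
  toFun p := p.1 + (γ p.1 + p.2) • ν
  invFun y := ((ℝ ∙ ν)ᗮ.orthogonalProjectionOnto y, height ν γ y)
  left_inv p := by
    simp [height, orthogonalProjectionOnto_add_smul hν, inner_add_smul hν]
  right_inv y := by
    simp [height, coe_orthogonalProjectionOnto hν]
  continuous_toFun := by fun_prop
  continuous_invFun := by unfold height; fun_prop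

theorem graphHomeo_apply (hν : ‖ν‖ = 1) (hγ : Continuous γ) (p : (ℝ ∙ ν)ᗮ × ℝ) :
    graphHomeo hν hγ p = p.1 + (γ p.1 + p.2) • ν := rfl

theorem height_graphHomeo (hν : ‖ν‖ = 1) (hγ : Continuous γ) (p : (ℝ ∙ ν)ᗮ × ℝ) :
    height ν γ (graphHomeo hν hγ p) = p.2 :=
  congrArg Prod.snd ((graphHomeo hν hγ).symm_apply_apply p)

theorem height_graphMap (hν : ‖ν‖ = 1) (x : (ℝ ∙ ν)ᗮ) : height ν γ (graphMap ν γ x) = 0 := by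
  simp [height, graphMap, orthogonalProjectionOnto_add_smul hν, inner_add_smul hν]

theorem mem_range_graphMap (hν : ‖ν‖ = 1) {y : Space N} :
    y ∈ range (graphMap ν γ) ↔ height ν γ y = 0 := by
  constructor
  · rintro ⟨x, rfl⟩
    exact height_graphMap hν x
  · intro h
    refine ⟨(ℝ ∙ ν)ᗮ.orthogonalProjectionOnto y, ?_⟩
    rw [graphMap, coe_orthogonalProjectionOnto hν, ← sub_eq_zero.1 h, sub_add_cancel]

theorem frontier_height_neg (hν : ‖ν‖ = 1) (hγ : Continuous γ) :
    frontier {y | height ν γ y < 0} = {y | height ν γ y = 0} := by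
  have hc : Continuous (height ν γ) := by unfold height; fun_prop
  have ho : IsOpenMap (height ν γ) := isOpenMap_snd.comp (graphHomeo hν hγ).symm.isOpenMap
  have := ho.preimage_frontier_eq_frontier_preimage hc (Iio 0)
  rw [frontier_Iio] at this
  exact this.symm

theorem graphHomeo_measurePreserving (hν : ‖ν‖ = 1) (hγ : Continuous γ) :
    MeasurePreserving (graphHomeo hν hγ) := by
  have h1 : MeasurePreserving (fun p : (ℝ ∙ ν)ᗮ × ℝ => (p.1, γ p.1 + p.2)) :=
    (MeasurePreserving.id (volume : Measure (ℝ ∙ ν)ᗮ)).skew_product (μc := volume) (μd := volume)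
      (g := fun x s => γ x + s) (by simp only [Function.uncurry_def]; fun_prop)
      (ae_of_all _ fun x => map_add_left_eq_self volume (γ x))
  have h2 : MeasurePreserving (fun p : (ℝ ∙ ν)ᗮ × ℝ =>
      (LinearIsometryEquiv.toSpanUnitSingleton (𝕜 := ℝ) ν hν p.2, p.1)) :=
    ((LinearIsometryEquiv.toSpanUnitSingleton (𝕜 := ℝ) ν hν).measurePreserving.prod
      (MeasurePreserving.id _)).comp Measure.measurePreserving_swap
  have h3 := ((ℝ ∙ ν).measurePreserving_measurableEquivProd (0 : Space N)).symm
  rw [InnerProductSpace.euclideanHausdorffMeasure_eq_volume] at h3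
  convert (h3.comp h2).comp h1 using 1
  funext p
  simp [graphHomeo_apply, Submodule.measurableEquivProd_symm_apply, add_comm]

theorem integral_fderiv_eq_zero {E : Type*} [NormedAddCommGroup E] [NormedSpace ℝ E]
    [FiniteDimensional ℝ E] [MeasurableSpace E] [BorelSpace E] {μ : Measure E} [μ.IsAddHaarMeasure]
    {f : E → ℝ} (hf : ContDiff ℝ 1 f) (hc : HasCompactSupport f) (v : E) :
    ∫ x, fderiv ℝ f x v ∂μ = 0 := by
  have hd : Continuous fun x => fderiv ℝ f x v :=
    (hf.continuous_fderiv (by simp)).clm_apply continuous_const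
  have := integral_mul_fderiv_eq_neg_fderiv_mul_of_integrable (μ := μ) (f := fun _ => (1 : ℝ))
    (g := f) (v := v) (by simp)
    (by simpa using hd.integrable_of_hasCompactSupport (hc.fderiv_apply ℝ v))
    (by simpa using hf.continuous.integrable_of_hasCompactSupport hc)
    (fun x _ => by fun_prop) (fun x _ => hf.differentiable (by simp) x)
  simpa using this

/-- The divergence theorem on the region below a graph, in terms of the parametrization of the
graph. -/
theorem setIntegral_fderiv_height_neg (hν : ‖ν‖ = 1) (hγ : ContDiff ℝ 1 γ) {ψ : Space N → ℝ}
    (hψ : ContDiff ℝ 1 ψ) (hc : HasCompactSupport ψ) (e : Space N) :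
    ∫ y in {y | height ν γ y < 0}, fderiv ℝ ψ y e =
      ∫ x, (inner ℝ ν e - fderiv ℝ γ x ((ℝ ∙ ν)ᗮ.orthogonalProjectionOnto e)) *
        ψ (graphMap ν γ x) := by
  set H := graphHomeo hν hγ.continuous with hH
  set w := (ℝ ∙ ν)ᗮ.orthogonalProjectionOnto e with hw
  have he : e = w + (inner ℝ ν e : ℝ) • ν := by
    rw [hw, coe_orthogonalProjectionOnto hν, sub_add_cancel]
  set τ : ℝ := inner ℝ ν e
  have hψ' : Continuous (fderiv ℝ ψ) := hψ.continuous_fderiv (by simp)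
  have hγ' : Continuous (fderiv ℝ γ) := hγ.continuous_fderiv (by simp)
  have hψd : ∀ y, HasFDerivAt ψ (fderiv ℝ ψ y) y := fun y =>
    (hψ.differentiable (by simp) y).hasFDerivAt
  have hpre : {y | height ν γ y < 0} = H.symm ⁻¹' (univ ×ˢ Iio 0) := by
    ext y
    obtain ⟨p, rfl⟩ := H.surjective y
    simp [H, height_graphHomeo]
  -- The derivative of `ψ` along the horizontal curves `x ↦ H (x, s)`.
  have hhor : ∀ s x, HasFDerivAt (fun x => ψ (H (x, s)))
      ((fderiv ℝ ψ (H (x, s))).comp ((ℝ ∙ ν)ᗮ.subtypeL + (fderiv ℝ γ x).smulRight ν)) x := by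
    intro s x
    refine (hψd _).comp x ?_
    have hγd : HasFDerivAt γ (fderiv ℝ γ x) x := (hγ.differentiable (by simp) x).hasFDerivAt
    exact (ℝ ∙ ν)ᗮ.subtypeL.hasFDerivAt.add ((hγd.add_const s).smul_const ν)
  have hver : ∀ x s, HasDerivAt (fun s => ψ (H (x, s))) (fderiv ℝ ψ (H (x, s)) ν) s := by
    intro x s
    refine (hψd (H (x, s))).comp_hasDerivAt s ?_
    have h1 := ((hasDerivAt_id s).const_add (γ x)).smul_const ν
    simpa [H, graphHomeo_apply] using h1.const_add (x : Space N)
  have hHs : ∀ s, ContDiff ℝ 1 fun x : (ℝ ∙ ν)ᗮ => H (x, s) := fun s =>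
    (ℝ ∙ ν)ᗮ.subtypeL.contDiff.add ((hγ.add contDiff_const).smul contDiff_const)
  have hHx : ∀ x, ContDiff ℝ 1 fun s : ℝ => H (x, s) := fun x => by
    simp only [H, graphHomeo_apply]; fun_prop
  have hcs : ∀ s, HasCompactSupport fun x : (ℝ ∙ ν)ᗮ => ψ (H (x, s)) := fun s =>
    hc.comp_isClosedEmbedding (H.isClosedEmbedding.comp
      (Isometry.of_dist_eq fun a b => by simp [Prod.dist_eq]).isClosedEmbedding)
  have hcx : ∀ x, HasCompactSupport fun s : ℝ => ψ (H (x, s)) := fun x =>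
    hc.comp_isClosedEmbedding (H.isClosedEmbedding.comp
      (Isometry.of_dist_eq fun a b => by simp [Prod.dist_eq]).isClosedEmbedding)
  -- In the straightened coordinates, `∂ₑψ` is the sum of `A`, a horizontal derivative, whose
  -- integral over each slice `s = const` vanishes, and of `B`, a multiple of the `s`-derivative,
  -- which integrates over `s < 0` to the value of `ψ` on the graph.
  let A : (ℝ ∙ ν)ᗮ × ℝ → ℝ := fun p => fderiv ℝ (fun x => ψ (H (x, p.2))) p.1 w
  let B : (ℝ ∙ ν)ᗮ × ℝ → ℝ := fun p => (τ - fderiv ℝ γ p.1 w) * fderiv ℝ ψ (H p) ν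
  have hA : ∀ p, A p = fderiv ℝ ψ (H p) (w + fderiv ℝ γ p.1 w • ν) := fun p => by
    simp only [A, (hhor p.2 p.1).fderiv]
    rfl
  have hAB : ∀ p, fderiv ℝ ψ (H p) e = A p + B p := fun p => by
    rw [hA, he]
    simp only [B, map_add, map_smul, smul_eq_mul]
    ring
  have hcomp : HasCompactSupport fun p => fderiv ℝ ψ (H p) := (hc.fderiv ℝ).comp_homeomorph H
  have hAi : Integrable A := by
    refine Continuous.integrable_of_hasCompactSupport ?_ ?_
    · rw [funext hA]
      have := H.continuous
      fun_prop
    · refine hcomp.mono fun p hp => ?_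
      contrapose! hp
      rw [Function.notMem_support] at hp ⊢
      rw [hA, hp]; rfl
  have hBi : Integrable B := by
    refine Continuous.integrable_of_hasCompactSupport ?_ ?_
    · have := H.continuous
      fun_prop
    · refine hcomp.mono fun p hp => ?_
      contrapose! hp
      rw [Function.notMem_support] at hp ⊢
      simp only [B, hp, zero_apply, mul_zero]
  have hmp : MeasurePreserving H := graphHomeo_measurePreserving hν hγ.continuous
  rw [hpre, ← hmp.setIntegral_preimage_emb H.measurableEmbedding, ← preimage_comp,
    H.symm_comp_self, preimage_id]
  simp_rw [hAB]
  rw [integral_add hAi.integrableOn hBi.integrableOn]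
  have hA0 : ∫ p in univ ×ˢ Iio (0 : ℝ), A p = 0 := by
    rw [Measure.volume_eq_prod, ← Measure.prod_restrict, Measure.restrict_univ, integral_prod_symm]
    · refine integral_eq_zero_of_ae (ae_of_all _ fun s => ?_)
      exact integral_fderiv_eq_zero (hψ.comp (hHs s)) (hcs s) w
    · have := hAi.integrableOn (s := univ ×ˢ Iio (0 : ℝ))
      rwa [IntegrableOn, Measure.volume_eq_prod, ← Measure.prod_restrict,
        Measure.restrict_univ] at this
  rw [hA0, zero_add, Measure.volume_eq_prod, setIntegral_prod _ hBi.integrableOn,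
    Measure.restrict_univ]
  refine integral_congr_ae (ae_of_all _ fun x => ?_)
  simp only [B]
  rw [integral_const_mul, ← integral_Iic_eq_integral_Iio]
  congr 1
  have hd : (fun s => fderiv ℝ ψ (H (x, s)) ν) = deriv fun s => ψ (H (x, s)) :=
    funext fun s => (hver x s).deriv.symm
  have hint := HasCompactSupport.integral_Iic_deriv_eq (hψ.comp (hHx x)) (hcx x) 0
  rw [hd]
  refine hint.trans ?_
  simp [H, graphHomeo_apply, graphMap]

theorem height_hasFDerivAt (hγ : ContDiff ℝ 1 γ) (y : Space N) :
    HasFDerivAt (height ν γ) (innerSL ℝ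
      (ν - ((gradient γ ((ℝ ∙ ν)ᗮ.orthogonalProjectionOnto y) : (ℝ ∙ ν)ᗮ) : Space N))) y := by
  have h1 := (hγ.differentiable (by simp) ((ℝ ∙ ν)ᗮ.orthogonalProjectionOnto y)).hasFDerivAt
  have h2 := (innerSL ℝ ν).hasFDerivAt (x := y) |>.sub
    (h1.comp y (ℝ ∙ ν)ᗮ.orthogonalProjectionOnto.hasFDerivAt)
  refine h2.congr_fderiv (ContinuousLinearMap.ext fun z => ?_)
  have h3 : fderiv ℝ γ ((ℝ ∙ ν)ᗮ.orthogonalProjectionOnto y)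
      ((ℝ ∙ ν)ᗮ.orthogonalProjectionOnto z) =
      inner ℝ ((gradient γ ((ℝ ∙ ν)ᗮ.orthogonalProjectionOnto y) : (ℝ ∙ ν)ᗮ) : Space N) z := by
    rw [← Submodule.inner_orthogonalProjectionOnto_eq_of_mem_left, ← innerSL_gradient]
    rfl
  simp [h3]

theorem norm_sub_gradient (hν : ‖ν‖ = 1) (a : (ℝ ∙ ν)ᗮ) :
    ‖ν - (a : Space N)‖ = √(1 + ‖a‖ ^ 2) := by
  rw [eq_comm, Real.sqrt_eq_iff_eq_sq (by positivity) (norm_nonneg _), norm_sub_sq_real,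
    inner_orthogonal, hν]
  simp

/-- The outward normal of a region which coincides, near the point of parameter `x` of the graph of
`γ`, with the region below the graph. -/
theorem outwardNormal_graphMap (hν : ‖ν‖ = 1) (hγ : ContDiff ℝ 1 γ) {Ω : Set (Space N)}
    {x : (ℝ ∙ ν)ᗮ} (hΩ : ∀ᶠ y in 𝓝 (graphMap ν γ x), y ∈ Ω ↔ height ν γ y < 0) :
    IsOutwardNormal Ω (graphMap ν γ x)
      ((√(1 + ‖gradient γ x‖ ^ 2))⁻¹ • (ν - ((gradient γ x : (ℝ ∙ ν)ᗮ) : Space N))) := by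
  have hpos : 0 < √(1 + ‖gradient γ x‖ ^ 2) := by positivity
  have hP : (ℝ ∙ ν)ᗮ.orthogonalProjectionOnto (graphMap ν γ x) = x :=
    orthogonalProjectionOnto_add_smul hν x _
  have hd := height_hasFDerivAt hγ (graphMap ν γ x)
  rw [hP] at hd
  have := isOutwardNormal_of_hasFDerivAt hd
    (norm_pos_iff.1 (by rw [norm_sub_gradient hν]; exact hpos)) (height_graphMap hν x) hΩ
  rwa [norm_sub_gradient hν] at this

end BelowGraph

/-! ### The divergence theorem on a Lyapunov domain -/

section Domain

open Module Filter
open scoped Topology Manifold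

variable {N : ℕ} {Ω : Set (Space N)}

/-- The frontier of a set is determined locally. -/
theorem mem_frontier_congr {X : Type*} [TopologicalSpace X] {s t : Set X} {x : X}
    (h : ∀ᶠ y in 𝓝 x, y ∈ s ↔ y ∈ t) : x ∈ frontier s ↔ x ∈ frontier t := by
  have h1 : x ∈ closure s ↔ x ∈ closure t := by
    rw [mem_closure_iff_frequently, mem_closure_iff_frequently]
    exact frequently_congr h
  have h2 : x ∈ interior s ↔ x ∈ interior t := by
    rw [mem_interior_iff_mem_nhds, mem_interior_iff_mem_nhds]
    exact eventually_congr h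
  rw [frontier, frontier, Set.mem_sdiff, Set.mem_sdiff, h1, h2]

/-- Near each boundary point, a Lyapunov domain lies below a `C¹` graph over the hyperplane
orthogonal to `ν`; only the restriction of the given function to this hyperplane matters. -/
theorem IsLyapunovDomain.exists_height (hΩ : IsLyapunovDomain Ω) {x : Space N}
    (hx : x ∈ frontier Ω) : ∃ (ν : Space N) (γ : (ℝ ∙ ν)ᗮ → ℝ) (r : ℝ),
      ‖ν‖ = 1 ∧ ContDiff ℝ 1 γ ∧ 0 < r ∧
      ∀ y ∈ Metric.ball x r, y ∈ Ω ↔ height ν γ y < 0 := by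
  obtain ⟨ν, g, r, hν, hg, hr, h⟩ := hΩ.local_graph x hx
  refine ⟨ν, fun z => g z, r, hν, hg.comp (ℝ ∙ ν)ᗮ.subtypeL.contDiff, hr, fun y hy => ?_⟩
  rw [h y hy, height, coe_orthogonalProjectionOnto hν, sub_neg]

section LocalGraph

variable {ν : Space N} {γ : (ℝ ∙ ν)ᗮ → ℝ} {x₀ : Space N} {r : ℝ}

theorem mem_frontier_iff_of_height (hν : ‖ν‖ = 1) (hγ : ContDiff ℝ 1 γ)
    (hloc : ∀ y ∈ Metric.ball x₀ r, y ∈ Ω ↔ height ν γ y < 0) {y : Space N}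
    (hy : y ∈ Metric.ball x₀ r) : y ∈ frontier Ω ↔ y ∈ range (graphMap ν γ) := by
  rw [mem_range_graphMap hν, mem_frontier_congr (t := {y | height ν γ y < 0}),
    frontier_height_neg hν hγ.continuous]
  · rfl
  · filter_upwards [Metric.isOpen_ball.mem_nhds hy] with z hz using hloc z hz

theorem outwardNormal_of_height (hν : ‖ν‖ = 1) (hγ : ContDiff ℝ 1 γ)
    (hloc : ∀ y ∈ Metric.ball x₀ r, y ∈ Ω ↔ height ν γ y < 0) {x : (ℝ ∙ ν)ᗮ}
    (hx : graphMap ν γ x ∈ Metric.ball x₀ r) :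
    IsOutwardNormal Ω (graphMap ν γ x)
      ((√(1 + ‖gradient γ x‖ ^ 2))⁻¹ • (ν - ((gradient γ x : (ℝ ∙ ν)ᗮ) : Space N))) :=
  outwardNormal_graphMap hν hγ <| by
    filter_upwards [Metric.isOpen_ball.mem_nhds hx] with z hz using hloc z hz

/-- The divergence theorem for functions supported in a ball in which the domain lies below a
graph. -/
theorem setIntegral_fderiv_of_height (hν : ‖ν‖ = 1) (hγ : ContDiff ℝ 1 γ)
    (hloc : ∀ y ∈ Metric.ball x₀ r, y ∈ Ω ↔ height ν γ y < 0) (hΩ : IsOpen Ω) {ψ : Space N → ℝ}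
    (hψ : ContDiff ℝ 1 ψ) (hc : HasCompactSupport ψ) (hs : tsupport ψ ⊆ Metric.ball x₀ r)
    (e : Space N) :
    ∫ y in Ω, fderiv ℝ ψ y e =
      ∫ y, inner ℝ (outwardNormal Ω y) e * ψ y ∂surfaceMeasure Ω := by
  have hψ0 : ∀ y ∉ Metric.ball x₀ r, ψ y = 0 := fun y hy =>
    image_eq_zero_of_notMem_tsupport fun h => hy (hs h)
  have hdψ0 : ∀ y ∉ Metric.ball x₀ r, fderiv ℝ ψ y = 0 := fun y hy =>
    image_eq_zero_of_notMem_tsupport fun h => hy (hs (tsupport_fderiv_subset ℝ h))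
  have hHm : MeasurableSet {y | height ν γ y < 0} := by
    have hγc := hγ.continuous
    have : Continuous (height ν γ) := by unfold height; fun_prop
    exact (isOpen_Iio.preimage this).measurableSet
  have hRm : MeasurableSet (range (graphMap ν γ)) :=
    (graphMap_measurableEmbedding hν hγ.continuous).measurableSet_range
  have hvol : ∫ y in Ω, fderiv ℝ ψ y e = ∫ y in {y | height ν γ y < 0}, fderiv ℝ ψ y e := by
    rw [← integral_indicator hΩ.measurableSet, ← integral_indicator hHm]
    refine integral_congr_ae (ae_of_all _ fun y => ?_)
    by_cases hy : y ∈ Metric.ball x₀ r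
    · simp only [indicator, hloc y hy, mem_ofPred_eq]
    · simp [indicator, hdψ0 y hy]
  have hsurf : ∫ y, inner ℝ (outwardNormal Ω y) e * ψ y ∂surfaceMeasure Ω =
      ∫ y in range (graphMap ν γ), inner ℝ (outwardNormal Ω y) e * ψ y ∂μHE[N - 1] := by
    rw [surfaceMeasure, ← integral_indicator isClosed_frontier.measurableSet,
      ← integral_indicator hRm]
    refine integral_congr_ae (ae_of_all _ fun y => ?_)
    by_cases hy : y ∈ Metric.ball x₀ r
    · have hiff := mem_frontier_iff_of_height hν hγ hloc hy
      by_cases hf : y ∈ frontier Ω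
      · simp only [indicator_of_mem hf, indicator_of_mem (hiff.1 hf)]
      · simp only [indicator_of_notMem hf, indicator_of_notMem fun h => hf (hiff.2 h)]
    · simp [indicator, hψ0 y hy]
  rw [hvol, hsurf, setIntegral_fderiv_height_neg hν hγ hψ hc, setIntegral_range_graphMap hν hγ]
  refine integral_congr_ae (ae_of_all _ fun x => ?_)
  by_cases hx : graphMap ν γ x ∈ Metric.ball x₀ r
  · have hpos : 0 < √(1 + ‖gradient γ x‖ ^ 2) := by positivity
    simp only
    rw [(outwardNormal_of_height hν hγ hloc hx).outwardNormal_eq, real_inner_smul_left,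
      inner_sub_left, ← Submodule.inner_orthogonalProjectionOnto_eq_of_mem_left,
      ← innerSL_gradient, innerSL_apply_apply]
    field_simp
  · simp [hψ0 _ hx]

end LocalGraph

theorem IsLyapunovDomain.isOutwardNormal (hΩ : IsLyapunovDomain Ω) {x : Space N}
    (hx : x ∈ frontier Ω) : IsOutwardNormal Ω x (outwardNormal Ω x) := by
  obtain ⟨ν, γ, r, hν, hγ, hr, hloc⟩ := hΩ.exists_height hx
  have hxr : x ∈ Metric.ball x r := Metric.mem_ball_self hr
  obtain ⟨z, rfl⟩ := (mem_frontier_iff_of_height hν hγ hloc hxr).1 hx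
  have := outwardNormal_of_height hν hγ hloc hxr
  rwa [this.outwardNormal_eq]

theorem IsLyapunovDomain.isCompact_frontier (hΩ : IsLyapunovDomain Ω) : IsCompact (frontier Ω) :=
  hΩ.isBounded.isCompact_closure.of_isClosed_subset isClosed_frontier frontier_subset_closure

theorem IsLyapunovDomain.measure_frontier_lt_top (hΩ : IsLyapunovDomain Ω) :
    μHE[N - 1] (frontier Ω) < ⊤ := by
  refine hΩ.isCompact_frontier.measure_lt_top_of_nhdsWithin fun x hx => ?_
  obtain ⟨ν, γ, r, hν, hγ, hr, hloc⟩ := hΩ.exists_height hx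
  refine ⟨frontier Ω ∩ Metric.ball x r, inter_mem self_mem_nhdsWithin
    (mem_nhdsWithin_of_mem_nhds (Metric.ball_mem_nhds x hr)), ?_⟩
  refine (measure_mono ?_).trans_lt
    (measure_inter_range_graphMap_lt_top hν hγ (isCompact_closedBall x r))
  exact fun y hy => ⟨Metric.ball_subset_closedBall hy.2,
    (mem_frontier_iff_of_height hν hγ hloc hy.2).1 hy.1⟩

/-- The boundary has finite `(N - 1)`-dimensional measure, hence is Lebesgue-null. -/
theorem IsLyapunovDomain.volume_frontier (hΩ : IsLyapunovDomain Ω) (hN : 1 ≤ N) :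
    volume (frontier Ω) = 0 := by
  rw [← EuclideanSpace.euclideanHausdorffMeasure_eq_volume]
  exact (Measure.euclideanHausdorffMeasure_zero_or_top (by omega : N - 1 < N) _).resolve_right
    hΩ.measure_frontier_lt_top.ne

theorem IsLyapunovDomain.isFiniteMeasure_surfaceMeasure (hΩ : IsLyapunovDomain Ω) :
    IsFiniteMeasure (surfaceMeasure Ω) :=
  ⟨by simpa [surfaceMeasure] using hΩ.measure_frontier_lt_top⟩

/-- The Hölder continuity of the normal is used only to make it measurable. -/
theorem IsLyapunovDomain.aestronglyMeasurable_outwardNormal (hΩ : IsLyapunovDomain Ω) :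
    AEStronglyMeasurable (outwardNormal Ω) (surfaceMeasure Ω) := by
  obtain ⟨C, α, hα, -, h⟩ := hΩ.normal_holder
  exact (h.continuousOn hα).aestronglyMeasurable isClosed_frontier.measurableSet

theorem IsLyapunovDomain.norm_outwardNormal (hΩ : IsLyapunovDomain Ω) :
    ∀ᵐ y ∂surfaceMeasure Ω, ‖outwardNormal Ω y‖ = 1 := by
  filter_upwards [ae_restrict_mem isClosed_frontier.measurableSet] with y hy
    using (hΩ.isOutwardNormal hy).1

theorem IsLyapunovDomain.integrable_inner_outwardNormal (hΩ : IsLyapunovDomain Ω) (e : Space N) :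
    Integrable (fun y => inner ℝ (outwardNormal Ω y) e) (surfaceMeasure Ω) := by
  have := hΩ.isFiniteMeasure_surfaceMeasure
  refine Integrable.of_bound (hΩ.aestronglyMeasurable_outwardNormal.inner
    aestronglyMeasurable_const) ‖e‖ ?_
  filter_upwards [hΩ.norm_outwardNormal] with y hy
  simpa [hy] using norm_inner_le_norm (𝕜 := ℝ) (outwardNormal Ω y) e

/-- The divergence theorem holds for functions supported near a given point. -/
theorem IsLyapunovDomain.exists_ball_setIntegral_fderiv (hΩ : IsLyapunovDomain Ω) (x : Space N) :
    ∃ r > 0, ∀ ψ : Space N → ℝ, ContDiff ℝ 1 ψ → HasCompactSupport ψ →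
      tsupport ψ ⊆ Metric.ball x r → ∀ e, ∫ y in Ω, fderiv ℝ ψ y e =
        ∫ y, inner ℝ (outwardNormal Ω y) e * ψ y ∂surfaceMeasure Ω := by
  by_cases hx : x ∈ frontier Ω
  · obtain ⟨ν, γ, r, hν, hγ, hr, hloc⟩ := hΩ.exists_height hx
    exact ⟨r, hr, fun ψ hψ hc hs e =>
      setIntegral_fderiv_of_height hν hγ hloc hΩ.isOpen hψ hc hs e⟩
  -- Away from the boundary both sides vanish: a small ball lies in `Ω` or in its complement.
  obtain ⟨r, hr, hB⟩ := Metric.isOpen_iff.1 isClosed_frontier.isOpen_compl x hx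
  refine ⟨r, hr, fun ψ hψ hc hs e => ?_⟩
  have hψ0 : ∀ y ∉ Metric.ball x r, ψ y = 0 := fun y hy =>
    image_eq_zero_of_notMem_tsupport fun h => hy (hs h)
  have hdψ0 : ∀ y ∉ Metric.ball x r, fderiv ℝ ψ y = 0 := fun y hy =>
    image_eq_zero_of_notMem_tsupport fun h => hy (hs (tsupport_fderiv_subset ℝ h))
  have hsurf : ∫ y, inner ℝ (outwardNormal Ω y) e * ψ y ∂surfaceMeasure Ω = 0 := by
    refine integral_eq_zero_of_ae ?_
    filter_upwards [ae_restrict_mem isClosed_frontier.measurableSet] with y hy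
    simp [hψ0 y fun h => hB h hy]
  rw [hsurf]
  have hcases : Metric.ball x r ⊆ Ω ∨ Metric.ball x r ⊆ Ωᶜ := by
    refine (convex_ball x r).isPreconnected.subset_or_subset hΩ.isOpen
      isClosed_closure.isOpen_compl (disjoint_compl_right_iff_subset.2 subset_closure)
      (fun y hy => ?_) |>.imp_right fun h => h.trans (compl_subset_compl.2 subset_closure)
    by_contra hcon
    rw [mem_union, not_or, notMem_compl_iff] at hcon
    exact hB hy ⟨hcon.2, fun h => hcon.1 (interior_subset h)⟩
  rcases hcases with h | h
  · rw [setIntegral_eq_integral_of_forall_compl_eq_zero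
      fun y hy => by rw [hdψ0 y fun hy' => hy (h hy')]; rfl]
    exact integral_fderiv_eq_zero hψ hc e
  · exact setIntegral_eq_zero_of_forall_eq_zero
      fun y hy => by rw [hdψ0 y fun hy' => h hy' hy]; rfl

/-- The divergence theorem on a Lyapunov domain. -/
theorem IsLyapunovDomain.setIntegral_fderiv (hΩ : IsLyapunovDomain Ω) {ψ : Space N → ℝ}
    (hψ : ContDiff ℝ 1 ψ) (hc : HasCompactSupport ψ) (e : Space N) :
    ∫ y in Ω, fderiv ℝ ψ y e =
      ∫ y, inner ℝ (outwardNormal Ω y) e * ψ y ∂surfaceMeasure Ω := by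
  choose r hr hloc using hΩ.exists_ball_setIntegral_fderiv
  obtain ⟨t, -, ht⟩ := hc.elim_nhds_subcover (fun x => Metric.ball x (r x))
    fun x _ => Metric.ball_mem_nhds x (hr x)
  obtain ⟨ρ, hρ⟩ := SmoothPartitionOfUnity.exists_isSubordinate 𝓘(ℝ, Space N)
    (isClosed_tsupport ψ) (fun x : t => Metric.ball (x : Space N) (r x))
    (fun _ => Metric.isOpen_ball) (by rwa [iUnion_subtype])
  let ψi : t → Space N → ℝ := fun i y => ρ i y * ψ y
  have hψi : ∀ i, ContDiff ℝ 1 (ψi i) := fun i =>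
    ((ρ i).contMDiff.contDiff.of_le (by simp)).mul hψ
  have hci : ∀ i, HasCompactSupport (ψi i) := fun i => hc.mul_left
  have hsi : ∀ i, tsupport (ψi i) ⊆ Metric.ball (i : Space N) (r i) := fun i =>
    (tsupport_mul_subset_left).trans (hρ i)
  have hsum : ∀ y, ψ y = ∑ i, ψi i y := fun y => by
    by_cases hy : y ∈ tsupport ψ
    · simp only [ψi]
      rw [← Finset.sum_mul, ← finsum_eq_sum_of_fintype, ρ.sum_eq_one hy, one_mul]
    · simp [ψi, image_eq_zero_of_notMem_tsupport hy]
  have hfd : ∀ y, fderiv ℝ ψ y e = ∑ i, fderiv ℝ (ψi i) y e := fun y => by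
    rw [funext hsum, fderiv_fun_sum fun i _ => (hψi i).differentiable (by simp) y]
    simp
  have hint : ∀ i, Integrable fun y => fderiv ℝ (ψi i) y e := fun i =>
    (((hψi i).continuous_fderiv (by simp)).clm_apply
      continuous_const).integrable_of_hasCompactSupport ((hci i).fderiv_apply ℝ e)
  have hint' : ∀ i, Integrable (fun y => inner ℝ (outwardNormal Ω y) e * ψi i y)
      (surfaceMeasure Ω) := fun i => by
    obtain ⟨C, hC⟩ := (hci i).exists_bound_of_continuous (hψi i).continuous
    exact (hΩ.integrable_inner_outwardNormal e).mul_bdd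
      (hψi i).continuous.aestronglyMeasurable (ae_of_all _ hC)
  simp_rw [hfd]
  rw [integral_finsetSum _ fun i _ => (hint i).integrableOn]
  simp_rw [hsum, Finset.mul_sum]
  rw [integral_finsetSum _ fun i _ => hint' i]
  exact Finset.sum_congr rfl fun i _ => hloc i _ (hψi i) (hci i) (hsi i) e

theorem halfIndicator_ae_eq (h : volume (frontier Ω) = 0) :
    halfIndicator Ω =ᵐ[volume] Ω.indicator 1 := by
  have : ∀ᵐ y, y ∉ frontier Ω := measure_eq_zero_iff_ae_notMem.1 h
  filter_upwards [this] with y hy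
  simp [halfIndicator, indicator, hy]

theorem integral_halfIndicator_mul (hΩ : IsOpen Ω) (h : volume (frontier Ω) = 0)
    (k : Space N → ℝ) : ∫ y, halfIndicator Ω y * k y = ∫ y in Ω, k y := by
  rw [← integral_indicator hΩ.measurableSet]
  refine integral_congr_ae ?_
  filter_upwards [halfIndicator_ae_eq h] with y hy
  rw [hy]
  by_cases hy : y ∈ Ω <;> simp [hy]

theorem IsLyapunovDomain.isCompactDensity_halfIndicator (hΩ : IsLyapunovDomain Ω) (hN : 1 ≤ N) :
    IsCompactDensity (halfIndicator Ω) volume := by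
  constructor
  · refine Integrable.congr ?_ (halfIndicator_ae_eq (hΩ.volume_frontier hN)).symm
    exact (integrable_indicator_iff hΩ.isOpen.measurableSet).2
      (integrableOn_const hΩ.isBounded.measure_lt_top.ne)
  · refine ⟨⟨closure Ω, hΩ.isBounded.isCompact_closure⟩, ae_of_all _ fun y hy => ?_⟩
    by_contra h
    have h1 : y ∉ Ω := fun h' => h (subset_closure h')
    have h2 : y ∉ frontier Ω := fun h' => h (frontier_subset_closure h')
    exact hy (by simp [halfIndicator, h1, h2])

theorem IsLyapunovDomain.isCompactDensity_outwardNormal (hΩ : IsLyapunovDomain Ω) (i : Fin N) :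
    IsCompactDensity (fun y => outwardNormal Ω y i) (surfaceMeasure Ω) := by
  constructor
  · simpa [EuclideanSpace.inner_single_right] using
      hΩ.integrable_inner_outwardNormal (EuclideanSpace.single i 1)
  · refine ⟨⟨frontier Ω, hΩ.isCompact_frontier⟩, ?_⟩
    filter_upwards [ae_restrict_mem isClosed_frontier.measurableSet] with y hy _ using hy

/-- The divergence theorem in the form `∂ᵢ H_Ω = - nᵢ δ_S`. -/
theorem IsLyapunovDomain.integral_outwardNormal_mul (hΩ : IsLyapunovDomain Ω) (hN : 1 ≤ N)
    {ψ : Space N → ℝ} (hψ : ContDiff ℝ 1 ψ) (hc : HasCompactSupport ψ) (i : Fin N) :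
    ∫ y, outwardNormal Ω y i * ψ y ∂surfaceMeasure Ω =
      ∫ y, halfIndicator Ω y * fderiv ℝ ψ y (EuclideanSpace.single i 1) := by
  rw [integral_halfIndicator_mul hΩ.isOpen (hΩ.volume_frontier hN), hΩ.setIntegral_fderiv hψ hc]
  simp [EuclideanSpace.inner_single_right]

end Domain

/-! ### Derivatives of averaged test functions -/

section Distributions

open Filter
open scoped Topology

variable {N : ℕ}

theorem lineDeriv_test_apply (φ : Test N) (v p : Space N × ℝ) :
    (∂_{v} φ : Test N) p = fderiv ℝ φ p v := by
  rw [TestFunction.lineDerivOp_eq_lineDerivCLM ℝ, TestFunction.lineDerivCLM_eq_fderivCLM,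
    TestFunction.fderivCLM_apply_of_le _ (by simp)]

theorem Test.hasFDerivAt (φ : Test N) (p : Space N × ℝ) : HasFDerivAt φ (fderiv ℝ φ p) p :=
  (φ.contDiff.differentiable (by simp) p).hasFDerivAt

theorem dx_apply (i : Fin N) (V : Distr N) (φ : Test N) :
    dx i V φ = -V (∂_{((EuclideanSpace.single i 1, 0) : Space N × ℝ)} φ) := by
  rw [← map_neg]
  exact Distribution.lineDerivOp_apply_apply _ _ _

theorem dt_apply (V : Distr N) (φ : Test N) :
    dt V φ = -V (∂_{((0, 1) : Space N × ℝ)} φ) := by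
  rw [← map_neg]
  exact Distribution.lineDerivOp_apply_apply _ _ _

/-- Averages of translates of a test function are differentiated under the integral sign. -/
theorem fderiv_avg_apply {Y : Type} [MeasurableSpace Y] {ρ : Measure Y} {f : Y → ℝ}
    {j : Y → Space N × ℝ} (hf : Integrable f ρ) (hj : Measurable j) (φ : Test N)
    (p v : Space N × ℝ) :
    fderiv ℝ (fun z => ∫ y, f y • φ (z + j y) ∂ρ) p v =
      ∫ y, f y • (∂_{v} φ : Test N) (p + j y) ∂ρ := by
  obtain ⟨C, hC⟩ := (φ.hasCompactSupport.fderiv ℝ).exists_bound_of_continuous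
    (φ.contDiff.continuous_fderiv (by simp))
  rw [(avg_hasFDerivAt hf hj φ.contDiff φ.hasCompactSupport p).fderiv,
    ContinuousLinearMap.integral_apply
      (avg_integrable hf hj (φ.contDiff.continuous_fderiv (by simp)) hC p)]
  simp [lineDeriv_test_apply]

theorem lineDeriv_spaceAvgOf {f : Space N → ℝ} {μ : Measure (Space N)} (h : IsCompactDensity f μ)
    (φ : Test N) (v : Space N × ℝ) : (∂_{v} (spaceAvgOf h φ) : Test N) = spaceAvgOf h (∂_{v} φ) := by
  ext p
  rw [lineDeriv_test_apply]
  exact fderiv_avg_apply h.1 measurable_shift φ p v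

theorem cutoff_zero : cutoff 0 = 1 := Real.smoothTransition.one_of_one_le (by norm_num)

theorem cutoff_of_neg_one_le {t : ℝ} (ht : -1 ≤ t) : cutoff t = 1 :=
  Real.smoothTransition.one_of_one_le (by linarith)

theorem exists_test_time_bound (φ : Test N) : ∃ T : ℝ, ∀ p, φ p ≠ 0 → p.2 ≤ T := by
  obtain ⟨T, hT⟩ := exists_time_bound ⟨tsupport φ, φ.hasCompactSupport⟩
  exact ⟨T, fun p hp => hT p (subset_tsupport _ hp)⟩

/-- The tail integral in time commutes with space derivatives. -/
theorem lineDeriv_timeTail (φ : Test N) (v : Space N) :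
    (∂_{((v, 0) : Space N × ℝ)} (timeTail φ) : Test N) =
      timeTail (∂_{((v, 0) : Space N × ℝ)} φ) := by
  ext p
  -- A common truncation time turns both tails into averages against a compactly supported weight.
  obtain ⟨T, hT⟩ := exists_test_time_bound φ
  obtain ⟨T', hT'⟩ := exists_test_time_bound (∂_{((v, 0) : Space N × ℝ)} φ : Test N)
  let S := max T T'
  have hS : ∀ q, φ q ≠ 0 → q.2 ≤ S := fun q hq => (hT q hq).trans (le_max_left _ _)
  have hS' : ∀ q, (∂_{((v, 0) : Space N × ℝ)} φ : Test N) q ≠ 0 → q.2 ≤ S := fun q hq =>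
    (hT' q hq).trans (le_max_right _ _)
  have heq : (timeTail φ : Space N × ℝ → ℝ) = fun q =>
      (∫ s, truncHeaviside (S + 2) s • φ (q + (0, s))) * cutoff q.2 :=
    funext fun q => timeTail_eq hS q
  have heq' : timeTail (∂_{((v, 0) : Space N × ℝ)} φ) p =
      (∫ s, truncHeaviside (S + 2) s • (∂_{((v, 0) : Space N × ℝ)} φ : Test N) (p + (0, s)))
        * cutoff p.2 := timeTail_eq hS' p
  have hfi := truncHeaviside_integrable (S + 2)
  have hI := avg_hasFDerivAt hfi (measurable_timeShift (N := N)) φ.contDiff φ.hasCompactSupport p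
  have hcd : ContDiff ℝ ∞ cutoff :=
    Real.smoothTransition.contDiff.comp (contDiff_id.add contDiff_const)
  have hcut : HasFDerivAt (fun q : Space N × ℝ => cutoff q.2)
      ((deriv cutoff p.2) • ContinuousLinearMap.snd ℝ (Space N) ℝ) p :=
    ((hcd.differentiable (by simp) p.2).hasDerivAt).comp_hasFDerivAt p hasFDerivAt_snd
  have hprod := (hI.mul hcut).fderiv
  rw [lineDeriv_test_apply, heq, heq',
    ← fderiv_avg_apply hfi (measurable_timeShift (N := N)) φ p (v, 0), hI.fderiv]
  refine (congrArg (fun L : Space N × ℝ →L[ℝ] ℝ => L (v, 0)) hprod).trans ?_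
  simp [mul_comm]

theorem integral_heaviside_mul (k : ℝ → ℝ) :
    ∫ s, heaviside s * k s = ∫ s in Ioi 0, k s := by
  rw [← integral_indicator measurableSet_Ioi]
  refine integral_congr_ae ?_
  have : ∀ᵐ s : ℝ, s ≠ 0 := by simp [ae_iff]
  filter_upwards [this] with s hs
  rcases lt_or_gt_of_ne hs with h | h
  · simp [heaviside, h, h.le]
  · simp [heaviside, h, h.le, hs]

/-- Near `[0, ∞)`, the time derivative of the tail integral of `φ` is `-φ`. -/
theorem lineDeriv_time_timeTail (φ : Test N) {p : Space N × ℝ} (hp : -1 < p.2) :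
    (∂_{((0, 1) : Space N × ℝ)} (timeTail φ) : Test N) p = -φ p := by
  obtain ⟨x, t⟩ := p
  simp only at hp
  have hcont : Continuous fun s => φ (x, s) := φ.continuous.comp (by fun_prop)
  have hint : Integrable fun s => φ (x, s) :=
    hcont.integrable_of_hasCompactSupport (φ.hasCompactSupport.comp_isClosedEmbedding
      (Isometry.of_dist_eq fun a b => by simp [Prod.dist_eq]).isClosedEmbedding)
  have htail : ∀ s, ∫ r, heaviside r * φ (x, s + r) = (∫ r, φ (x, r)) - ∫ r in Iic s, φ (x, r) := by
    intro s
    rw [integral_heaviside_mul, 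
      ← intervalIntegral.integral_Iic_add_Ioi hint.integrableOn hint.integrableOn (b := s),
      add_sub_cancel_left]
    have hshift := (measurePreserving_add_left volume s).setIntegral_preimage_emb
      (measurableEmbedding_addLeft s) (fun r => φ (x, r)) (Ioi s)
    simpa using hshift
  have hd : HasDerivAt (fun s => (∫ r, φ (x, r)) - ∫ r in Iic s, φ (x, r)) (-φ (x, t)) t := by
    have h1 : ∀ s, ∫ r in Iic s, φ (x, r) = (∫ r in Iic 0, φ (x, r)) + ∫ r in (0)..s, φ (x, r) :=
      fun s => by
        rw [← intervalIntegral.integral_Iic_sub_Iic hint.integrableOn hint.integrableOn]; ring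
    have h2 : (fun s => (∫ r, φ (x, r)) - ∫ r in Iic s, φ (x, r)) =
        fun s => (∫ r, φ (x, r)) - ((∫ r in Iic 0, φ (x, r)) + ∫ r in (0)..s, φ (x, r)) :=
      funext fun s => by rw [← h1 s]
    rw [h2]
    simpa using ((intervalIntegral.integral_hasDerivAt_right (hcont.intervalIntegrable 0 t)
      (hcont.stronglyMeasurableAtFilter _ _) hcont.continuousAt).const_add _).const_sub _
  have hd' : HasDerivAt (fun s => timeTail φ (x, s)) (-φ (x, t)) t := by
    refine hd.congr_of_eventuallyEq ?_
    filter_upwards [Ioi_mem_nhds hp] with s hs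
    rw [timeTail_apply, cutoff_of_neg_one_le (le_of_lt hs), one_mul, htail]
  have hc := (Test.hasFDerivAt (timeTail φ) (x, t)).comp_hasDerivAt t
    ((hasDerivAt_const t x).prodMk (hasDerivAt_id t))
  rw [lineDeriv_test_apply]
  exact hc.unique hd'

/-- Test functions which vanish for `t > -1` are annihilated by distributions which vanish for
`t < 0`. -/
theorem eq_zero_of_vanish_past {U : Distr N}
    (hU : Distribution.IsVanishingOn U {p : Space N × ℝ | p.2 < 0}) {φ : Test N}
    (hφ : ∀ p : Space N × ℝ, -1 < p.2 → φ p = 0) : U φ = 0 := by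
  refine hU φ ?_
  have hcl : IsClosed {p : Space N × ℝ | p.2 ≤ -1} := isClosed_le continuous_snd continuous_const
  refine (closure_minimal (fun p hp => ?_) hcl).trans fun p (hp : p.2 ≤ -1) => ?_
  · by_contra h
    exact hp (hφ p (not_le.1 h))
  · exact lt_of_le_of_lt hp (by norm_num)

/-- The distribution `W = U ∗ₜ H(t)` satisfies `Δ W - c⁻² U,_t = δ(x) H(t)`. -/
theorem IsGreenFunction.timePrimitive_eq {c : ℝ} {U : Distr N} (hU : IsGreenFunction c U)
    (ψ : Test N) :
    (∑ i, dx i (dx i (timePrimitive U)) ψ) - (c ^ 2)⁻¹ * dt U ψ = ∫ s in Ioi 0, ψ (0, s) := by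
  have h1 := congrArg (fun V : Distr N => V (timeTail ψ)) hU.waveOp_eq
  -- The two sides differ by a test function which vanishes for `t > -1`.
  have htt : U (∂_{((0, 1) : Space N × ℝ)} (∂_{((0, 1) : Space N × ℝ)} (timeTail ψ) : Test N)) =
      -U (∂_{((0, 1) : Space N × ℝ)} ψ) := by
    rw [eq_neg_iff_add_eq_zero, ← map_add]
    refine eq_zero_of_vanish_past hU.vanish_past fun p hp => ?_
    have hev : (∂_{((0, 1) : Space N × ℝ)} (timeTail ψ) : Test N) =ᶠ[𝓝 p] fun q => -ψ q := by
      filter_upwards [(isOpen_Ioi.preimage continuous_snd).mem_nhds (mem_preimage.2 hp)] with q hq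
        using lineDeriv_time_timeTail ψ hq
    rw [add_apply, lineDeriv_test_apply, lineDeriv_test_apply, hev.fderiv_eq]
    simp
  have h0 : timeTail ψ (0, 0) = ∫ s in Ioi 0, ψ (0, s) := by
    rw [timeTail_apply, cutoff_zero, one_mul, integral_heaviside_mul]
    simp
  simp only [waveOp, Distribution.delta_apply] at h1
  rw [← h0]
  have h2 : (timeTail ψ) (0 : Space N × ℝ) = timeTail ψ (0, 0) := rfl
  rw [← h2, ← h1, sub_apply, sum_apply, smul_apply, dt_apply, dt_apply, dt_apply, neg_neg, htt]
  simp only [dx_apply, neg_neg, timePrimitive_apply, lineDeriv_timeTail, smul_eq_mul]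

end Distributions

/-! ### Convolution with the characteristic function of the domain -/

section Convolution

variable {N : ℕ} {Ω : Set (Space N)}

/-- The divergence theorem on test functions: averaging against `nᵢ δ_S` is differentiating the
average over the domain. -/
theorem IsLyapunovDomain.spaceAvgOf_outwardNormal (hΩ : IsLyapunovDomain Ω) (hN : 1 ≤ N) (i : Fin N)
    (φ : Test N) :
    spaceAvgOf (hΩ.isCompactDensity_outwardNormal i) φ =
      ∂_{((EuclideanSpace.single i 1, 0) : Space N × ℝ)}
        (spaceAvgOf (hΩ.isCompactDensity_halfIndicator hN) φ) := by
  rw [lineDeriv_spaceAvgOf]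
  ext ⟨x, t⟩
  have hφ : ContDiff ℝ ∞ fun y : Space N => φ (x + y, t) := φ.contDiff.comp (by fun_prop)
  have hc : HasCompactSupport fun y : Space N => φ (x + y, t) :=
    φ.hasCompactSupport.comp_isClosedEmbedding
      (Isometry.of_dist_eq fun a b => by simp [Prod.dist_eq]).isClosedEmbedding
  rw [spaceAvgOf_apply, spaceAvgOf_apply,
    hΩ.integral_outwardNormal_mul hN (hφ.of_le (by simp)) hc]
  refine integral_congr_ae (ae_of_all _ fun y => ?_)
  have hd : HasFDerivAt (fun y : Space N => φ (x + y, t))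
      ((fderiv ℝ φ (x + y, t)).comp (ContinuousLinearMap.inl ℝ (Space N) ℝ)) y := by
    refine (Test.hasFDerivAt φ (x + y, t)).comp y ?_
    exact ((hasFDerivAt_id y).const_add x).prodMk (hasFDerivAt_const t y)
  simp only
  rw [lineDeriv_test_apply, hd.fderiv]
  simp

/-- `V ∗ₓ nᵢ δ_S = -(∂ᵢ V) ∗ₓ H_Ω`. -/
theorem IsLyapunovDomain.convNormalLayer_apply (hΩ : IsLyapunovDomain Ω) (hN : 1 ≤ N) (V : Distr N)
    (i : Fin N) (φ : Test N) :
    convNormalLayer V Ω i φ = -dx i V (spaceAvgOf (hΩ.isCompactDensity_halfIndicator hN) φ) := by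
  rw [convNormalLayer, spaceConv_apply _ (hΩ.isCompactDensity_outwardNormal i), dx_apply, neg_neg,
    hΩ.spaceAvgOf_outwardNormal hN]

theorem measurable_halfIndicator (hΩ : IsOpen Ω) : Measurable (halfIndicator Ω) :=
  Measurable.ite hΩ.measurableSet measurable_const
    (Measurable.ite isClosed_frontier.measurableSet measurable_const measurable_const)

theorem norm_halfIndicator_mul_heaviside_le (p : Space N × ℝ) :
    ‖halfIndicator Ω p.1 * heaviside p.2‖ ≤ 1 := by
  unfold halfIndicator heaviside
  split_ifs <;> norm_num

theorem regular_halfIndicator_mul_heaviside_apply (hΩ : IsOpen Ω) (φ : Test N) :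
    regular (fun p : Space N × ℝ => halfIndicator Ω p.1 * heaviside p.2) φ =
      ∫ s in Ioi 0, ∫ y, halfIndicator Ω y * φ (y, s) := by
  have hm : Measurable fun p : Space N × ℝ => halfIndicator Ω p.1 * heaviside p.2 :=
    ((measurable_halfIndicator hΩ).comp measurable_fst).mul
      (heaviside_measurable.comp measurable_snd)
  have hloc : LocallyIntegrable fun p : Space N × ℝ => halfIndicator Ω p.1 * heaviside p.2 :=
    (locallyIntegrable_const (1 : ℝ)).mono hm.aestronglyMeasurable (ae_of_all _ fun p => by
      simpa using norm_halfIndicator_mul_heaviside_le p)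
  have hφ : Integrable (φ : Space N × ℝ → ℝ) :=
    φ.continuous.integrable_of_hasCompactSupport φ.hasCompactSupport
  have hint : Integrable fun p : Space N × ℝ => φ p * (halfIndicator Ω p.1 * heaviside p.2) :=
    hφ.mul_bdd hm.aestronglyMeasurable (ae_of_all _ norm_halfIndicator_mul_heaviside_le)
  refine (TestFunction.integralAgainstBilinCLM_eq_integral (hloc.locallyIntegrableOn _)).trans ?_
  simp only [ContinuousLinearMap.mul_apply']
  rw [Measure.volume_eq_prod, integral_prod_symm _ hint, ← integral_heaviside_mul]
  refine integral_congr_ae (ae_of_all _ fun s => ?_)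
  simp only
  rw [← integral_const_mul]
  exact integral_congr_ae (ae_of_all _ fun y => by ring)

end Convolution

end WaveGauss

theorem lemma4p1 (N : ℕ) (hN : 1 ≤ N) (c : ℝ) (hc : 0 < c)
    (Ω : Set (Space N)) (hΩ : IsLyapunovDomain Ω)
    (U : Distr N) (hU : IsGreenFunction c U) :
    -(∑ i : Fin N, convNormalLayer (dx i (timePrimitive U)) Ω i)
        - (c ^ 2)⁻¹ • dt (spaceConv U (halfIndicator Ω) volume)
      = regular (fun p : Space N × ℝ => halfIndicator Ω p.1 * heaviside p.2) := by
  ext φ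
  have hH := hΩ.isCompactDensity_halfIndicator hN
  have hdt : dt (spaceConv U (halfIndicator Ω) volume) φ = dt U (spaceAvgOf hH φ) := by
    rw [dt_apply, dt_apply, spaceConv_apply _ hH, lineDeriv_spaceAvgOf]
  rw [sub_apply, neg_apply, sum_apply, smul_apply, hdt, smul_eq_mul,
    regular_halfIndicator_mul_heaviside_apply hΩ.isOpen]
  simp only [hΩ.convNormalLayer_apply hN, Finset.sum_neg_distrib, neg_neg]
  rw [hU.timePrimitive_eq]
  simp only [spaceAvgOf_apply, zero_add]
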